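/- Let $\mathbb D$ be the open unit disc in $\mathbb C$ and $\mathbb T$ its boundary circle. The Dirichlet space $\mathcal D$ consists of all holomorphic functions $g(z)=\sum_{k\ge 0} a_k z^k$ on $\mathbb D$ such that $\mathcal D(g):=\frac1\pi\int_{\mathbb D}|g'|^2\,dA<\infty$, where $A$ is area measure, and it is equipped with the norm $\|g\|_{\mathcal D}=\bigl(\mathcal D(g)+\|g\|_{H^2}^2\bigr)^{1/2}$, where $\|g\|_{H^2}^2=\sum_{k\ge0}|a_k|^2$. The logarithmic capacity of a closed set $E\subset\mathbb T$ is $$c(E)=\Bigl(\inf_{\mu}\iint \log\frac{2}{|z-w|}\,d\mu(z)\,d\mu(w)\Bigr)^{-1},$$ where $\mu$ runs over the Borel probability measures carried by $E$ (so $c(E)=0$ if and only if every such $\mu$ has infinite energy; in particular $c(\emptyset)=0$). **Theorem.** Let $E\subset\mathbb T$ be a closed set with $c(E)=0$. Let $g\in\mathcal D$ be non-vanishing on $\mathbb D$, and let $f:E\to\mathbb C$ be continuous and non-vanishing on $E$. Then there exists a sequence of polynomials $(P_n)$ with complex coefficients, none of which vanishes anywhere on the closed unit disc $\overline{\mathbb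 D}$, such that $\|P_n-g\|_{\mathcal D}\to0$ and $P_n\to f$ uniformly on $E$ as $n\to\infty$. -/

import Mathlib

open scoped ENNReal Topology

/-- The logarithmic kernel `log (2 / |z - w|)`, with value `∞` on the diagonal, for points `z`, `w`
of the unit circle. It is nonnegative there since the circle has diameter `2`. -/
noncomputable def logKernel (z w : ℂ) : ℝ≥0∞ :=
  if z = w then ⊤ else ENNReal.ofReal (Real.log (2 / ‖z - w‖))

/-- The logarithmic energy of a Borel measure carried by the unit circle. -/
noncomputable def logEnergy (μ : MeasureTheory.Measure ℂ) : ℝ≥0∞ :=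
  ∫⁻ z, ∫⁻ w, logKernel z w ∂μ ∂μ

/-- The logarithmic capacity of a closed subset `E` of the unit circle: the reciprocal of the
infimum of the energies of the Borel probability measures carried by `E`.
The capacity of the empty set is `0`. -/
noncomputable def logCapacity (E : Set ℂ) : ℝ≥0∞ :=
  (⨅ (μ : MeasureTheory.Measure ℂ) (_ : MeasureTheory.IsProbabilityMeasure μ)
    (_ : μ Eᶜ = 0), logEnergy μ)⁻¹

/-- The Dirichlet integral `(1/π) ∫ |f'|² dA` over the open unit disc. -/
noncomputable def dirichletIntegral (f : ℂ → ℂ) : ℝ≥0∞ :=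
  (ENNReal.ofReal Real.pi)⁻¹ * ∫⁻ z in Metric.ball (0 : ℂ) 1, ‖deriv f z‖ₑ ^ 2

/-- The squared Hardy norm of a function `f` holomorphic in the open unit disc: the sum of the
squared moduli of its Taylor coefficients at `0`. -/
noncomputable def hardyNormSq (f : ℂ → ℂ) : ℝ≥0∞ :=
  ∑' k : ℕ, ‖iteratedDeriv k f 0 / (k.factorial : ℂ)‖ₑ ^ 2

/-- The Dirichlet space norm, `‖f‖² = (1/π) ∫ |f'|² dA + ‖f‖²_{H²}`, of a function `f`
holomorphic in the open unit disc. Only the values of `f` in the disc matter. -/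
noncomputable def dirichletNorm (f : ℂ → ℂ) : ℝ≥0∞ :=
  (dirichletIntegral f + hardyNormSq f) ^ (1 / 2 : ℝ)

/-- The Dirichlet space: functions holomorphic in the open unit disc with finite Dirichlet
integral. Elements are represented by functions on `ℂ` whose values off the disc are irrelevant. -/
def dirichletSpace : Set (ℂ → ℂ) :=
  {f | DifferentiableOn ℂ f (Metric.ball 0 1) ∧ dirichletIntegral f < ⊤}

open MeasureTheory Metric Set Filter

/-! Work with exponentials, which never vanish. Write `g = exp l` on the disc and replace `g` by a
dilate `g_r(z) = g(rz)`, close to `g` in norm and equal to `exp (l (r z))` near the closed disc. On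
`E`, approximate `f` by `exp φ` with `φ` continuous. If `q` is analytic near the closed disc, has
small Dirichlet norm, and is close to `φ - l (r ·)` on `E`, then `H = g_r exp q` is zero-free on the
closed disc and close to `f` on `E`. Moreover `H - g_r = g_r (exp q - 1)` is small in norm, provided
that `Re q` has an upper bound fixed before the norm of `q` is made small. A Taylor polynomial of
`H` close enough to it uniformly on the closed disc is zero-free too.

Such a `q` exists because `c(E) = 0`. The root is `exists_analytic_of_logCapacity_eq_zero`: some `u`
with `Re u ≥ 0` and norm at most `1` has `Re u > M` on all of `E`. Otherwise Hahn-Banach and Riesz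
give a probability measure `μ` on `E` with `∫ Re u dμ ≤ M` for every competitor `u`. Testing this on
the normalised dilated potentials of `μ` itself, whose squared norms are at most twice their
energies, bounds those energies by `2 M ^ 2`. Fatou then gives `μ` finite energy, which is
impossible.

From `u`, the function `1 - exp (-ε u)` is bounded, small in norm and nearly `1` on `E`. Repeated
backward shifts turn it into functions close to `z ^ (-N)` on `E` (`exists_cutoff`). As Laurent
polynomials are dense in `C(E)`, multiplying by a polynomial gives `q` (`exists_small_interpolant`).

The logarithm `φ` exists up to small error because `E` has measure zero: a zero-free Laurent
polynomial near `f` maps `E` into a set missing a whole real line through `0`, so a branch of the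
logarithm applies (`exists_continuousMap_log_approx`). -/

/-! ### Taylor coefficients on the unit disc. -/

/-- The `k`-th Taylor coefficient of `f` at `0`. -/
noncomputable def taylorCoeff (f : ℂ → ℂ) (k : ℕ) : ℂ :=
  iteratedDeriv k f 0 / (k.factorial : ℂ)

theorem hasSum_taylorCoeff {f : ℂ → ℂ} {R : ℝ} (hf : DifferentiableOn ℂ f (ball 0 R)) {z : ℂ}
    (hz : z ∈ ball (0 : ℂ) R) : HasSum (fun k => taylorCoeff f k * z ^ k) (f z) := by
  refine (Complex.hasSum_taylorSeries_on_ball hf hz).congr_fun fun k => ?_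
  simp only [taylorCoeff, sub_zero, smul_eq_mul]
  ring

theorem hasFPowerSeriesOnBall_of_hasSum {f : ℂ → ℂ} {a : ℕ → ℂ}
    (h : ∀ z ∈ ball (0 : ℂ) 1, HasSum (fun k => a k * z ^ k) (f z)) :
    HasFPowerSeriesOnBall f (FormalMultilinearSeries.ofScalars ℂ a) 0 1 := by
  refine ⟨?_, one_pos, ?_⟩
  · refine ENNReal.le_of_forall_nnreal_lt fun r hr => ?_
    apply FormalMultilinearSeries.le_radius_of_summable_norm
    have := (h (r : ℂ) (by simpa using hr)).summable.norm
    simpa [FormalMultilinearSeries.ofScalars_norm] using this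
  · intro y hy
    have := h y (by rw [← Metric.eball_ofReal, ENNReal.ofReal_one]; exact hy)
    simpa [FormalMultilinearSeries.ofScalars_apply_eq, mul_comm] using this

theorem taylorCoeff_eq_of_hasSum {f : ℂ → ℂ} {a : ℕ → ℂ}
    (h : ∀ z ∈ ball (0 : ℂ) 1, HasSum (fun k => a k * z ^ k) (f z)) : taylorCoeff f = a := by
  have h1 := (hasFPowerSeriesOnBall_of_hasSum h).hasFPowerSeriesAt
  have h2 := h1.analyticAt.hasFPowerSeriesAt
  have := h2.eq_formalMultilinearSeries h1
  exact FormalMultilinearSeries.ofScalars_series_injective ℂ ℂ this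

theorem differentiableOn_of_hasSum {f : ℂ → ℂ} {a : ℕ → ℂ}
    (h : ∀ z ∈ ball (0 : ℂ) 1, HasSum (fun k => a k * z ^ k) (f z)) :
    DifferentiableOn ℂ f (ball 0 1) := by
  have := (hasFPowerSeriesOnBall_of_hasSum h).differentiableOn
  rwa [← ENNReal.ofReal_one, Metric.eball_ofReal] at this

theorem taylorCoeff_zero (f : ℂ → ℂ) : taylorCoeff f 0 = f 0 := by
  simp [taylorCoeff]

theorem taylorCoeff_deriv (f : ℂ → ℂ) (k : ℕ) :
    taylorCoeff (deriv f) k = (k + 1) * taylorCoeff f (k + 1) := by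
  have : (k.factorial : ℂ) ≠ 0 := by exact_mod_cast k.factorial_ne_zero
  have h2 : (k + 1 : ℂ) ≠ 0 := by exact_mod_cast k.succ_ne_zero
  simp only [taylorCoeff, ← iteratedDeriv_succ', Nat.factorial_succ]
  push_cast
  field_simp

/-! ### Parseval on circles and area integrals. -/

/-- Parseval for polynomials passes to the limit along partial sums, which are dominated by the
constant `∑ ‖c k‖`. -/
theorem circleAverage_norm_sq_of_summable {c : ℕ → ℂ} {F : ℂ → ℂ} (hc : Summable fun k => ‖c k‖)
    (hF : ∀ z ∈ sphere (0 : ℂ) 1, HasSum (fun k => c k * z ^ k) (F z)) :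
    Real.circleAverage (fun z => ‖F z‖ ^ 2) 0 1 = ∑' k, ‖c k‖ ^ 2 := by
  let p : ℕ → Polynomial ℂ := fun n => ∑ k ∈ Finset.range n, Polynomial.monomial k (c k)
  have hpe : ∀ n z, (p n).eval z = ∑ k ∈ Finset.range n, c k * z ^ k := by
    intro n z; simp [p, Polynomial.eval_finsetSum]
  have hpc : ∀ n k, (p n).coeff k = if k < n then c k else 0 := by
    intro n k
    simp [p, Polynomial.coeff_monomial]
  have hps : ∀ n, ∑ i ∈ (p n).support, ‖(p n).coeff i‖ ^ 2 = ∑ k ∈ Finset.range n, ‖c k‖ ^ 2 := by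
    intro n
    rw [Finset.sum_subset (s₂ := Finset.range n)]
    · refine Finset.sum_congr rfl fun k hk => ?_
      rw [hpc, if_pos (Finset.mem_range.1 hk)]
    · intro k hk
      rw [Polynomial.mem_support_iff, hpc] at hk
      by_contra h
      exact hk (if_neg (by simpa using h))
    · intro k _ hk
      rw [Polynomial.notMem_support_iff.1 hk]; simp
  have hbound : ∀ n, ∀ z ∈ sphere (0 : ℂ) 1, ‖(p n).eval z‖ ≤ ∑' k, ‖c k‖ := by
    intro n z hz
    rw [hpe]
    refine (norm_sum_le _ _).trans ?_
    have : ∀ k, ‖c k * z ^ k‖ = ‖c k‖ := by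
      intro k; rw [norm_mul, norm_pow, mem_sphere_zero_iff_norm.1 hz]; simp
    simp only [this]
    exact hc.sum_le_tsum _ (fun _ _ => norm_nonneg _)
  have hsq : Summable fun k => ‖c k‖ ^ 2 := by
    refine Summable.of_norm_bounded_eventually_nat hc ?_
    filter_upwards [hc.tendsto_atTop_zero.eventually (ge_mem_nhds (zero_lt_one))] with k hk
    rw [Real.norm_of_nonneg (by positivity), sq]
    exact mul_le_of_le_one_left (norm_nonneg _) hk
  refine tendsto_nhds_unique ?_ hsq.hasSum.tendsto_sum_nat
  simp only [← hps, Polynomial.sum_sq_norm_coeff_eq_circleAverage, Real.circleAverage]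
  refine Tendsto.const_smul ?_ _
  refine intervalIntegral.tendsto_integral_filter_of_dominated_convergence
    (fun _ => (∑' k, ‖c k‖) ^ 2) ?_ ?_ (by simp) ?_
  · refine Eventually.of_forall fun n => Continuous.aestronglyMeasurable ?_
    have := (p n).continuous
    fun_prop
  · refine Eventually.of_forall fun n => Eventually.of_forall fun θ _ => ?_
    rw [Real.norm_of_nonneg (by positivity)]
    gcongr
    exact hbound n _ (circleMap_mem_sphere _ zero_le_one _)
  · refine Eventually.of_forall fun θ _ => ?_
    have := (hF _ (circleMap_mem_sphere 0 zero_le_one θ)).tendsto_sum_nat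
    simp only [← hpe] at this
    exact (this.norm).pow 2

theorem lintegral_enorm_sq_circle {f : ℂ → ℂ} (hf : DifferentiableOn ℂ f (ball 0 1)) {r : ℝ}
    (hr0 : 0 ≤ r) (hr : r < 1) :
    ∫⁻ θ in Ioo (-Real.pi) Real.pi, ‖f (r * Complex.exp (θ * Complex.I))‖ₑ ^ 2 =
      ENNReal.ofReal (2 * Real.pi) *
        ∑' k, ‖taylorCoeff f k‖ₑ ^ 2 * ENNReal.ofReal (r ^ (2 * k)) := by
  have hmem : ∀ z ∈ sphere (0 : ℂ) 1, (r : ℂ) * z ∈ ball (0 : ℂ) 1 := by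
    intro z hz
    rw [mem_sphere_zero_iff_norm] at hz
    simp [hz, abs_of_nonneg hr0, hr]
  have hrmem : (r : ℂ) ∈ ball (0 : ℂ) 1 := by simpa using hmem 1 (by simp)
  have hc : Summable fun k => ‖taylorCoeff f k * r ^ k‖ := (hasSum_taylorCoeff hf hrmem).summable.norm
  have hsq : Summable fun k => ‖taylorCoeff f k * r ^ k‖ ^ 2 := by
    refine Summable.of_norm_bounded_eventually_nat hc ?_
    filter_upwards [hc.tendsto_atTop_zero.eventually (ge_mem_nhds (zero_lt_one))] with k hk
    rw [Real.norm_of_nonneg (by positivity), sq]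
    exact mul_le_of_le_one_left (norm_nonneg _) hk
  have h := circleAverage_norm_sq_of_summable (F := fun z => f (r * z)) hc (by
    intro z hz
    convert hasSum_taylorCoeff hf (hmem z hz) using 2 with k
    ring)
  have hcont : Continuous fun θ : ℝ => ‖f (r * Complex.exp (θ * Complex.I))‖ ^ 2 := by
    refine (Continuous.norm ?_).pow 2
    refine hf.continuousOn.comp_continuous (by fun_prop) fun θ => hmem _ ?_
    simp [Complex.norm_exp_ofReal_mul_I]
  rw [Real.circleAverage_eq_integral_add (-Real.pi),
    intervalIntegral.integral_comp_add_right (fun θ => ‖f (r * circleMap 0 1 θ)‖ ^ 2)] at h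
  have e1 : (0 : ℝ) + -Real.pi = -Real.pi := by ring
  have e2 : 2 * Real.pi + -Real.pi = Real.pi := by ring
  rw [e1, e2, intervalIntegral.integral_of_le (by linarith [Real.pi_pos]),
    integral_Ioc_eq_integral_Ioo] at h
  have h2 : ∫ θ in Ioo (-Real.pi) Real.pi, ‖f (r * Complex.exp (θ * Complex.I))‖ ^ 2 =
      2 * Real.pi * ∑' k, ‖taylorCoeff f k * r ^ k‖ ^ 2 := by
    rw [← h, smul_eq_mul, mul_inv_cancel_left₀ (by positivity)]
    simp [circleMap]
  have hint : IntegrableOn (fun θ : ℝ => ‖f (r * Complex.exp (θ * Complex.I))‖ ^ 2)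
      (Ioo (-Real.pi) Real.pi) :=
    (hcont.integrableOn_Icc).mono_set Ioo_subset_Icc_self
  have h3 := ofReal_integral_eq_lintegral_ofReal hint (Eventually.of_forall fun θ => by positivity)
  rw [h2, ENNReal.ofReal_mul (by positivity),
    ENNReal.ofReal_tsum_of_nonneg (fun _ => by positivity) hsq] at h3
  have e3 : ∀ z : ℂ, ENNReal.ofReal (‖z‖ ^ 2) = ‖z‖ₑ ^ 2 := fun z => by
    rw [ENNReal.ofReal_pow (norm_nonneg _), ofReal_norm]
  simp only [e3] at h3
  rw [← h3]
  congr 1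
  refine tsum_congr fun k => ?_
  rw [enorm_mul, mul_pow, ← e3 (_ ^ k), norm_pow, Complex.norm_real, Real.norm_of_nonneg hr0,
    ← pow_mul, mul_comm k 2]

/-- Polar coordinates, Parseval on each circle, and `∫₀¹ r ^ (2k+1) dr = 1 / (2k+2)`. Applied to
`f'` it computes the Dirichlet integral; applied to `f` it controls the area norm. -/
theorem lintegral_enorm_sq_ball {f : ℂ → ℂ} (hf : DifferentiableOn ℂ f (ball 0 1)) :
    ∫⁻ z in ball (0 : ℂ) 1, ‖f z‖ₑ ^ 2 =
      ENNReal.ofReal Real.pi * ∑' k : ℕ, ‖taylorCoeff f k‖ₑ ^ 2 / ((k : ℝ≥0∞) + 1) := by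
  classical
  -- Extension by zero gives global measurability, and radii `r ≥ 1` contribute nothing.
  set F : ℂ → ℂ := (ball (0 : ℂ) 1).piecewise f 0 with hF
  have hFm : Measurable F :=
    hf.continuousOn.measurable_piecewise continuousOn_const measurableSet_ball
  have hGm : Measurable fun z => ‖F z‖ₑ ^ 2 := hFm.enorm.pow_const 2
  have h1 : ∫⁻ z in ball (0 : ℂ) 1, ‖f z‖ₑ ^ 2 = ∫⁻ z, ‖F z‖ₑ ^ 2 := by
    rw [← lintegral_indicator measurableSet_ball]
    refine lintegral_congr fun z => ?_
    by_cases hz : z ∈ ball (0 : ℂ) 1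
    · simp only [indicator_of_mem hz, hF, piecewise_eq_of_mem _ _ _ hz]
    · simp [hF, hz]
  rw [h1, ← Complex.lintegral_comp_polarCoord_symm, _root_.polarCoord_target, Measure.volume_eq_prod,
    ← Measure.prod_restrict, lintegral_prod]
  swap
  · refine Measurable.aemeasurable ?_
    refine Measurable.smul (f := fun p : ℝ × ℝ => ENNReal.ofReal p.1) (by fun_prop) (hGm.comp ?_)
    have hm : Measurable
        fun p : ℝ × ℝ => (p.1 : ℂ) * (Real.cos p.2 + Real.sin p.2 * Complex.I) := by fun_prop
    simp only [← Complex.polarCoord_symm_apply] at hm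
    exact hm
  have h2 : ∀ r ∈ Ioi (0 : ℝ), ∫⁻ θ in Ioo (-Real.pi) Real.pi,
      ENNReal.ofReal r • ‖F (Complex.polarCoord.symm (r, θ))‖ₑ ^ 2 =
      (Ioo (0 : ℝ) 1).indicator (fun r => ∑' k, ENNReal.ofReal (2 * Real.pi) *
        (‖taylorCoeff f k‖ₑ ^ 2 * ENNReal.ofReal (r ^ (2 * k + 1)))) r := by
    intro r hr
    have hr0 : 0 < r := hr
    have e : ∀ θ : ℝ, Complex.polarCoord.symm (r, θ) = r * Complex.exp (θ * Complex.I) := by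
      intro θ
      rw [Complex.polarCoord_symm_apply, Complex.exp_mul_I]
      push_cast; rfl
    have en : ∀ θ : ℝ, ‖(r : ℂ) * Complex.exp (θ * Complex.I)‖ = r := by
      intro θ; simp [Complex.norm_exp_ofReal_mul_I, abs_of_pos hr0]
    simp only [e, smul_eq_mul]
    rw [lintegral_const_mul' _ _ ENNReal.ofReal_ne_top]
    by_cases h : r < 1
    · rw [indicator_of_mem (show r ∈ Ioo (0 : ℝ) 1 from ⟨hr0, h⟩)]
      have : ∀ θ : ℝ, F (r * Complex.exp (θ * Complex.I)) = f (r * Complex.exp (θ * Complex.I)) :=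
        fun θ => piecewise_eq_of_mem _ _ _ (by rw [mem_ball_zero_iff, en]; exact h)
      simp only [this]
      rw [lintegral_enorm_sq_circle hf hr0.le h, ← ENNReal.tsum_mul_left, ← ENNReal.tsum_mul_left]
      refine tsum_congr fun k => ?_
      rw [pow_succ r, ENNReal.ofReal_mul (by positivity : 0 ≤ r ^ (2 * k))]
      ring
    · rw [indicator_of_notMem (fun h' => h h'.2)]
      have : ∀ θ : ℝ, F (r * Complex.exp (θ * Complex.I)) = 0 :=
        fun θ => piecewise_eq_of_notMem _ _ _ (by rw [mem_ball_zero_iff, en]; exact h)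
      simp [this]
  rw [setLIntegral_congr_fun measurableSet_Ioi h2, lintegral_indicator measurableSet_Ioo,
    Measure.restrict_restrict measurableSet_Ioo, Ioo_inter_Ioi, max_self, lintegral_tsum,
    ← ENNReal.tsum_mul_left]
  swap
  · intro k; fun_prop
  refine tsum_congr fun k => ?_
  rw [lintegral_const_mul' _ _ ENNReal.ofReal_ne_top, lintegral_const_mul' _ _ (by finiteness)]
  have h3 : ∫⁻ r in Ioo (0 : ℝ) 1, ENNReal.ofReal (r ^ (2 * k + 1)) =
      ENNReal.ofReal (1 / (2 * k + 2)) := by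
    rw [← ofReal_integral_eq_lintegral_ofReal, ← integral_Ioc_eq_integral_Ioo,
      ← intervalIntegral.integral_of_le zero_le_one, integral_pow]
    · congr 1; push_cast; simp; ring
    · exact ((continuous_pow _).integrableOn_Icc).mono_set Ioo_subset_Icc_self
    · filter_upwards [ae_restrict_mem measurableSet_Ioo] with r hr
      exact pow_nonneg hr.1.le _
  rw [h3, mul_left_comm, ← ENNReal.ofReal_mul (by positivity)]
  have h4 : 2 * Real.pi * (1 / (2 * (k : ℝ) + 2)) = Real.pi * (k + 1 : ℝ)⁻¹ := by field_simp
  rw [h4, div_eq_mul_inv, ENNReal.ofReal_mul Real.pi_pos.le, ENNReal.ofReal_inv_of_pos (by positivity),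
    ENNReal.ofReal_add (by positivity) zero_le_one, ENNReal.ofReal_natCast, ENNReal.ofReal_one]
  ring

/-! ### The Dirichlet norm in terms of coefficients, and multiplier estimates. -/

/-- The square of the Dirichlet norm in terms of Taylor coefficients. -/
noncomputable def dirichletSum (f : ℂ → ℂ) : ℝ≥0∞ :=
  ∑' k : ℕ, ((k : ℝ≥0∞) + 1) * ‖taylorCoeff f k‖ₑ ^ 2

theorem dirichletIntegral_eq_tsum {f : ℂ → ℂ} (hf : DifferentiableOn ℂ f (ball 0 1)) :
    dirichletIntegral f = ∑' k : ℕ, (k : ℝ≥0∞) * ‖taylorCoeff f k‖ₑ ^ 2 := by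
  rw [dirichletIntegral, lintegral_enorm_sq_ball (hf.deriv isOpen_ball), ← mul_assoc,
    ENNReal.inv_mul_cancel (by simp [Real.pi_pos]) ENNReal.ofReal_ne_top, one_mul,
    (tsum_eq_zero_add' ENNReal.summable :
      ∑' k : ℕ, (k : ℝ≥0∞) * ‖taylorCoeff f k‖ₑ ^ 2 = _)]
  simp only [Nat.cast_zero, zero_mul, zero_add]
  refine tsum_congr fun k => ?_
  have e : ‖(k + 1 : ℂ)‖ₑ = (k : ℝ≥0∞) + 1 := by
    rw [← ofReal_norm]
    have : ‖(k + 1 : ℂ)‖ = k + 1 := by exact_mod_cast Complex.norm_natCast (k + 1)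
    rw [this, ENNReal.ofReal_add (by positivity) zero_le_one]; simp
  have h0 : (k : ℝ≥0∞) + 1 ≠ 0 := by simp
  have ht : (k : ℝ≥0∞) + 1 ≠ ⊤ := by finiteness
  rw [taylorCoeff_deriv, enorm_mul, mul_pow, e, div_eq_mul_inv, mul_right_comm, sq,
    mul_assoc ((k : ℝ≥0∞) + 1), ENNReal.mul_inv_cancel h0 ht, mul_one]
  push_cast
  ring

theorem dirichletNorm_eq {f : ℂ → ℂ} (hf : DifferentiableOn ℂ f (ball 0 1)) :
    dirichletNorm f = dirichletSum f ^ (1 / 2 : ℝ) := by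
  rw [dirichletNorm, dirichletIntegral_eq_tsum hf, hardyNormSq, dirichletSum, ← ENNReal.tsum_add]
  simp only [taylorCoeff, add_mul, one_mul]

theorem enorm_mul_add_mul_sq_le (s t : ℝ) (hs : 0 ≤ s) (ht : 0 ≤ t) (hst : s + t = 1) (x y : ℂ) :
    ‖(s : ℂ) * x + t * y‖ₑ ^ 2 ≤ ENNReal.ofReal s * ‖x‖ₑ ^ 2 + ENNReal.ofReal t * ‖y‖ₑ ^ 2 := by
  have e : ∀ z : ℂ, ‖z‖ₑ ^ 2 = ENNReal.ofReal (‖z‖ ^ 2) := fun z => by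
    rw [ENNReal.ofReal_pow (norm_nonneg _), ofReal_norm]
  rw [e, e, e, ← ENNReal.ofReal_mul hs, ← ENNReal.ofReal_mul ht,
    ← ENNReal.ofReal_add (by positivity) (by positivity)]
  refine ENNReal.ofReal_le_ofReal ?_
  have h1 : ‖(s : ℂ) * x + t * y‖ ≤ s * ‖x‖ + t * ‖y‖ := by
    refine (norm_add_le _ _).trans_eq ?_
    simp [abs_of_nonneg hs, abs_of_nonneg ht]
  have h2 := pow_le_pow_left₀ (norm_nonneg _) h1 2
  have h3 : t = 1 - s := by linarith
  subst h3
  nlinarith [mul_nonneg (mul_nonneg hs ht) (sq_nonneg (‖x‖ - ‖y‖))]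

theorem enorm_add_sq_le (x y : ℂ) : ‖x + y‖ₑ ^ 2 ≤ 2 * ‖x‖ₑ ^ 2 + 2 * ‖y‖ₑ ^ 2 := by
  have h := enorm_mul_add_mul_sq_le (1 / 2) (1 / 2) (by norm_num) (by norm_num) (by norm_num)
    (2 * x) (2 * y)
  have e : ((1 / 2 : ℝ) : ℂ) * (2 * x) + ((1 / 2 : ℝ) : ℂ) * (2 * y) = x + y := by
    push_cast; ring
  have e2 : ENNReal.ofReal (1 / 2) * 2 ^ 2 = 2 := by
    rw [show (2 : ℝ≥0∞) = ENNReal.ofReal 2 by simp, ← ENNReal.ofReal_pow (by norm_num),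
      ← ENNReal.ofReal_mul (by norm_num)]
    norm_num
  have e3 : ‖(2 : ℂ)‖ₑ = 2 := by
    rw [← ofReal_norm]; simp
  rw [e, enorm_mul, enorm_mul, mul_pow, mul_pow, ← mul_assoc, ← mul_assoc, e3, e2] at h
  exact h

theorem taylorCoeff_linear {f g : ℂ → ℂ} (hf : DifferentiableOn ℂ f (ball 0 1))
    (hg : DifferentiableOn ℂ g (ball 0 1)) (a b : ℂ) (k : ℕ) :
    taylorCoeff (fun z => a * f z + b * g z) k = a * taylorCoeff f k + b * taylorCoeff g k := by
  refine congrFun (taylorCoeff_eq_of_hasSum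
    (a := fun k => a * taylorCoeff f k + b * taylorCoeff g k) fun z hz => ?_) k
  refine (((hasSum_taylorCoeff hf hz).mul_left a).add
    ((hasSum_taylorCoeff hg hz).mul_left b)).congr_fun fun k => ?_
  ring

theorem taylorCoeff_congr {f g : ℂ → ℂ} (hg : DifferentiableOn ℂ g (ball 0 1))
    (h : EqOn f g (ball 0 1)) : taylorCoeff f = taylorCoeff g :=
  taylorCoeff_eq_of_hasSum fun z hz => by rw [h hz]; exact hasSum_taylorCoeff hg hz

theorem dirichletSum_congr {f g : ℂ → ℂ} (hg : DifferentiableOn ℂ g (ball 0 1))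
    (h : EqOn f g (ball 0 1)) : dirichletSum f = dirichletSum g := by
  simp only [dirichletSum, taylorCoeff_congr hg h]

/-- The squared norm is convex term by term; this makes the set of competitors in the Hahn-Banach
argument convex. -/
theorem dirichletSum_convex {f g : ℂ → ℂ} (hf : DifferentiableOn ℂ f (ball 0 1))
    (hg : DifferentiableOn ℂ g (ball 0 1)) {s t : ℝ} (hs : 0 ≤ s) (ht : 0 ≤ t) (hst : s + t = 1) :
    dirichletSum (fun z => s * f z + t * g z) ≤
      ENNReal.ofReal s * dirichletSum f + ENNReal.ofReal t * dirichletSum g := by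
  simp only [dirichletSum, ← ENNReal.tsum_mul_left, ← ENNReal.tsum_add, taylorCoeff_linear hf hg]
  refine ENNReal.tsum_le_tsum fun k => ?_
  refine (mul_le_mul_right (enorm_mul_add_mul_sq_le s t hs ht hst _ _) _).trans_eq ?_
  ring

theorem dirichletSum_add_le {f g : ℂ → ℂ} (hf : DifferentiableOn ℂ f (ball 0 1))
    (hg : DifferentiableOn ℂ g (ball 0 1)) :
    dirichletSum (fun z => f z + g z) ≤ 2 * dirichletSum f + 2 * dirichletSum g := by
  have e : ∀ k, taylorCoeff (fun z => f z + g z) k = taylorCoeff f k + taylorCoeff g k := by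
    intro k; simpa using taylorCoeff_linear hf hg 1 1 k
  simp only [dirichletSum, ← ENNReal.tsum_mul_left, ← ENNReal.tsum_add, e]
  refine ENNReal.tsum_le_tsum fun k => ?_
  refine (mul_le_mul_right (enorm_add_sq_le _ _) _).trans_eq ?_
  ring

theorem dirichletSum_const_mul {f : ℂ → ℂ} (hf : DifferentiableOn ℂ f (ball 0 1)) (a : ℂ) :
    dirichletSum (fun z => a * f z) = ‖a‖ₑ ^ 2 * dirichletSum f := by
  have e : ∀ k, taylorCoeff (fun z => a * f z) k = a * taylorCoeff f k := by
    intro k; simpa using taylorCoeff_linear hf hf a 0 k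
  simp only [dirichletSum, ← ENNReal.tsum_mul_left, e, enorm_mul, mul_pow]
  refine tsum_congr fun k => ?_
  ring

theorem dirichletIntegral_le_dirichletSum {f : ℂ → ℂ} (hf : DifferentiableOn ℂ f (ball 0 1)) :
    dirichletIntegral f ≤ dirichletSum f := by
  rw [dirichletIntegral_eq_tsum hf, dirichletSum]
  exact ENNReal.tsum_le_tsum fun k => by gcongr; exact le_self_add

theorem enorm_apply_zero_sq_le_dirichletSum (f : ℂ → ℂ) : ‖f 0‖ₑ ^ 2 ≤ dirichletSum f := by
  rw [dirichletSum]
  refine le_trans ?_ (ENNReal.le_tsum 0)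
  simp [taylorCoeff_zero]

/-- For `k ≥ 1` the weight `k + 1` is at most `2k`, so only the constant term needs separate care.
-/
theorem dirichletSum_le {f : ℂ → ℂ} (hf : DifferentiableOn ℂ f (ball 0 1)) :
    dirichletSum f ≤ 2 * dirichletIntegral f + ‖f 0‖ₑ ^ 2 := by
  rw [dirichletIntegral_eq_tsum hf, dirichletSum, ← ENNReal.tsum_mul_left,
    (tsum_eq_zero_add' ENNReal.summable :
      ∑' k : ℕ, ((k : ℝ≥0∞) + 1) * ‖taylorCoeff f k‖ₑ ^ 2 = _), add_comm]
  refine add_le_add ?_ (by simp [taylorCoeff_zero])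
  rw [(tsum_eq_zero_add' ENNReal.summable :
      ∑' k : ℕ, 2 * ((k : ℝ≥0∞) * ‖taylorCoeff f k‖ₑ ^ 2) = _)]
  refine le_trans ?_ le_add_self
  refine ENNReal.tsum_le_tsum fun k => ?_
  rw [← mul_assoc]
  gcongr
  push_cast
  rw [two_mul]
  gcongr
  exact le_add_self

theorem lintegral_enorm_sq_le_dirichletSum {f : ℂ → ℂ} (hf : DifferentiableOn ℂ f (ball 0 1)) :
    (ENNReal.ofReal Real.pi)⁻¹ * ∫⁻ z in ball (0 : ℂ) 1, ‖f z‖ₑ ^ 2 ≤ dirichletSum f := by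
  rw [lintegral_enorm_sq_ball hf, ← mul_assoc,
    ENNReal.inv_mul_cancel (by simp [Real.pi_pos]) ENNReal.ofReal_ne_top, one_mul, dirichletSum]
  refine ENNReal.tsum_le_tsum fun k => ?_
  have h1 : (1 : ℝ≥0∞) ≤ (k : ℝ≥0∞) + 1 := le_add_self
  exact (ENNReal.div_le_of_le_mul (le_mul_of_one_le_right' h1)).trans (le_mul_of_one_le_left' h1)

theorem dirichletSum_le_of_norm_le {f g : ℂ → ℂ} {K : ℝ≥0∞} (hK : K ≠ ⊤)
    (hf : DifferentiableOn ℂ f (ball 0 1)) (hg : DifferentiableOn ℂ g (ball 0 1))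
    (h0 : ‖f 0‖ₑ ≤ K * ‖g 0‖ₑ) (h : ∀ z ∈ ball (0 : ℂ) 1, ‖deriv f z‖ₑ ≤ K * ‖deriv g z‖ₑ) :
    dirichletSum f ≤ 3 * K ^ 2 * dirichletSum g := by
  have h1 : dirichletIntegral f ≤ K ^ 2 * dirichletIntegral g := by
    rw [dirichletIntegral, dirichletIntegral, mul_left_comm]
    refine mul_le_mul_right ?_ _
    rw [← lintegral_const_mul' _ _ (by finiteness)]
    refine setLIntegral_mono' measurableSet_ball fun z hz => ?_
    rw [← mul_pow]
    exact pow_le_pow_left' (h z hz) 2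
  calc dirichletSum f ≤ 2 * dirichletIntegral f + ‖f 0‖ₑ ^ 2 := dirichletSum_le hf
    _ ≤ 2 * (K ^ 2 * dirichletSum g) + K ^ 2 * dirichletSum g := by
        refine add_le_add (mul_le_mul_right (h1.trans ?_) _) ?_
        · gcongr; exact dirichletIntegral_le_dirichletSum hg
        · calc ‖f 0‖ₑ ^ 2 ≤ (K * ‖g 0‖ₑ) ^ 2 := by gcongr
            _ = K ^ 2 * ‖g 0‖ₑ ^ 2 := mul_pow _ _ _
            _ ≤ _ := by gcongr; exact enorm_apply_zero_sq_le_dirichletSum g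
    _ = _ := by ring

/-- Product rule and `‖x + y‖² ≤ 2‖x‖² + 2‖y‖²`: bounded functions with bounded derivative are
multipliers. The constant is `9 = 2 · 4 + 1`, the `1` coming from the value at `0`. -/
theorem dirichletSum_mul_le {F φ : ℂ → ℂ} {K : ℝ≥0∞} (hK : K ≠ ⊤)
    (hF : DifferentiableOn ℂ F (ball 0 1)) (hφ : DifferentiableOn ℂ φ (ball 0 1))
    (h0 : ∀ z ∈ ball (0 : ℂ) 1, ‖F z‖ₑ ≤ K) (h1 : ∀ z ∈ ball (0 : ℂ) 1, ‖deriv F z‖ₑ ≤ K) :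
    dirichletSum (fun z => F z * φ z) ≤ 9 * K ^ 2 * dirichletSum φ := by
  have hD : dirichletIntegral (fun z => F z * φ z) ≤ 4 * K ^ 2 * dirichletSum φ := by
    have hle : ∫⁻ z in ball (0 : ℂ) 1, ‖deriv (fun z => F z * φ z) z‖ₑ ^ 2 ≤
        2 * K ^ 2 * (∫⁻ z in ball (0 : ℂ) 1, ‖φ z‖ₑ ^ 2) +
          2 * K ^ 2 * ∫⁻ z in ball (0 : ℂ) 1, ‖deriv φ z‖ₑ ^ 2 := by
      rw [← lintegral_const_mul' _ _ (by finiteness), ← lintegral_const_mul' _ _ (by finiteness),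
        ← lintegral_add_left']
      · refine setLIntegral_mono' measurableSet_ball fun z hz => ?_
        have hFz := (hF.differentiableAt (isOpen_ball.mem_nhds hz))
        have hφz := (hφ.differentiableAt (isOpen_ball.mem_nhds hz))
        rw [deriv_fun_mul hFz hφz]
        refine (enorm_add_sq_le _ _).trans ?_
        rw [enorm_mul, enorm_mul, mul_pow, mul_pow, mul_assoc, mul_assoc]
        gcongr
        · exact h1 z hz
        · exact h0 z hz
      · exact ((hφ.continuousOn.aemeasurable measurableSet_ball).enorm.pow_const 2).const_mul _
    calc dirichletIntegral (fun z => F z * φ z)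
        ≤ 2 * K ^ 2 * ((ENNReal.ofReal Real.pi)⁻¹ * ∫⁻ z in ball (0 : ℂ) 1, ‖φ z‖ₑ ^ 2) +
          2 * K ^ 2 * dirichletIntegral φ := by
          rw [dirichletIntegral, dirichletIntegral]
          refine (mul_le_mul_right hle _).trans_eq ?_
          ring
      _ ≤ 2 * K ^ 2 * dirichletSum φ + 2 * K ^ 2 * dirichletSum φ := by
          gcongr
          · exact lintegral_enorm_sq_le_dirichletSum hφ
          · exact dirichletIntegral_le_dirichletSum hφ
      _ = _ := by ring
  calc dirichletSum (fun z => F z * φ z)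
      ≤ 2 * dirichletIntegral (fun z => F z * φ z) + ‖F 0 * φ 0‖ₑ ^ 2 := dirichletSum_le (hF.mul hφ)
    _ ≤ 2 * (4 * K ^ 2 * dirichletSum φ) + K ^ 2 * dirichletSum φ := by
        rw [enorm_mul, mul_pow]
        gcongr
        · exact h0 0 (by simp)
        · exact enorm_apply_zero_sq_le_dirichletSum φ
    _ = _ := by ring

theorem taylorCoeff_dslope {f : ℂ → ℂ} (hf : DifferentiableOn ℂ f (ball 0 1)) (k : ℕ) :
    taylorCoeff (dslope f 0) k = taylorCoeff f (k + 1) := by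
  refine congrFun (taylorCoeff_eq_of_hasSum (a := fun k => taylorCoeff f (k + 1)) fun z hz => ?_) k
  rcases eq_or_ne z 0 with rfl | hz0
  · rw [dslope_same]
    have : taylorCoeff f 1 = deriv f 0 := by simp [taylorCoeff]
    rw [← this]
    convert hasSum_single 0 ?_ using 1
    · simp
    · intro k hk; simp [hk]
  · rw [dslope_of_ne _ hz0, slope_def_field]
    have h := hasSum_taylorCoeff hf hz
    rw [← hasSum_nat_add_iff' 1] at h
    simp only [Finset.range_one, Finset.sum_singleton, pow_zero, mul_one, taylorCoeff_zero] at h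
    rw [sub_zero]
    refine (h.div_const z).congr_fun fun k => ?_
    field_simp
    ring

/-- `dslope f 0` is the backward shift of `f`; it moves each coefficient to a smaller weight. -/
theorem dirichletSum_dslope_le {f : ℂ → ℂ} (hf : DifferentiableOn ℂ f (ball 0 1)) :
    dirichletSum (dslope f 0) ≤ dirichletSum f := by
  simp only [dirichletSum, taylorCoeff_dslope hf]
  rw [(tsum_eq_zero_add' ENNReal.summable :
      ∑' k : ℕ, ((k : ℝ≥0∞) + 1) * ‖taylorCoeff f k‖ₑ ^ 2 = _)]
  refine le_trans ?_ le_add_self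
  refine ENNReal.tsum_le_tsum fun k => ?_
  gcongr
  exact_mod_cast k.le_succ

/-! ### Functions analytic near the closed disc. -/

theorem AnalyticOnNhd.exists_ball {f : ℂ → ℂ} (hf : AnalyticOnNhd ℂ f (closedBall 0 1)) :
    ∃ R > 1, DifferentiableOn ℂ f (ball 0 R) := by
  have hU : IsOpen {x | AnalyticAt ℂ f x} := isOpen_analyticAt ℂ f
  obtain ⟨δ, hδ, h⟩ := (isCompact_closedBall (0 : ℂ) 1).exists_thickening_subset_open hU hf
  refine ⟨1 + δ, by linarith, fun z hz => ?_⟩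
  rw [thickening_closedBall hδ zero_le_one] at h
  exact (h (by rwa [add_comm])).differentiableAt.differentiableWithinAt

theorem DifferentiableOn.analyticOnNhd_closedBall {f : ℂ → ℂ} {R : ℝ} (hR : 1 < R)
    (hf : DifferentiableOn ℂ f (ball 0 R)) : AnalyticOnNhd ℂ f (closedBall 0 1) :=
  (hf.analyticOnNhd isOpen_ball).mono (closedBall_subset_ball hR)

theorem AnalyticOnNhd.differentiableOn_ball {f : ℂ → ℂ}
    (hf : AnalyticOnNhd ℂ f (closedBall 0 1)) : DifferentiableOn ℂ f (ball 0 1) :=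
  hf.differentiableOn.mono ball_subset_closedBall

theorem AnalyticOnNhd.exists_enorm_le {f : ℂ → ℂ} (hf : AnalyticOnNhd ℂ f (closedBall 0 1)) :
    ∃ K : ℝ≥0∞, K ≠ ⊤ ∧ ∀ z ∈ closedBall (0 : ℂ) 1, ‖f z‖ₑ ≤ K ∧ ‖deriv f z‖ₑ ≤ K := by
  obtain ⟨A, hA⟩ := (isCompact_closedBall (0 : ℂ) 1).exists_bound_of_continuousOn hf.continuousOn
  obtain ⟨B, hB⟩ := (isCompact_closedBall (0 : ℂ) 1).exists_bound_of_continuousOn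
    hf.deriv.continuousOn
  refine ⟨ENNReal.ofReal (max A B), ENNReal.ofReal_ne_top, fun z hz => ?_⟩
  rw [← ofReal_norm, ← ofReal_norm]
  exact ⟨ENNReal.ofReal_le_ofReal ((hA z hz).trans (le_max_left _ _)),
    ENNReal.ofReal_le_ofReal ((hB z hz).trans (le_max_right _ _))⟩

theorem AnalyticOnNhd.exists_dirichletSum_mul_le {F : ℂ → ℂ}
    (hF : AnalyticOnNhd ℂ F (closedBall 0 1)) :
    ∃ C : ℝ≥0∞, C ≠ ⊤ ∧ ∀ φ : ℂ → ℂ, DifferentiableOn ℂ φ (ball 0 1) →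
      dirichletSum (fun z => F z * φ z) ≤ C * dirichletSum φ := by
  obtain ⟨K, hK, h⟩ := hF.exists_enorm_le
  exact ⟨9 * K ^ 2, by finiteness, fun φ hφ => dirichletSum_mul_le hK hF.differentiableOn_ball hφ
    (fun z hz => (h z (ball_subset_closedBall hz)).1)
    (fun z hz => (h z (ball_subset_closedBall hz)).2)⟩

theorem dirichletSum_one : dirichletSum (fun _ => 1) = 1 := by
  have : taylorCoeff (fun _ => 1) = fun k => if k = 0 then 1 else 0 := by
    refine taylorCoeff_eq_of_hasSum fun z _ => ?_
    convert hasSum_single 0 ?_ using 1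
    · simp
    · intro k hk; simp [hk]
  rw [dirichletSum, tsum_eq_single 0]
  · simp [this]
  · intro k hk; simp [this, hk]

theorem AnalyticOnNhd.dirichletSum_ne_top {F : ℂ → ℂ} (hF : AnalyticOnNhd ℂ F (closedBall 0 1)) :
    dirichletSum F ≠ ⊤ := by
  obtain ⟨C, hC, h⟩ := hF.exists_dirichletSum_mul_le
  have := h (fun _ => 1) (differentiableOn_const _)
  simp only [mul_one, dirichletSum_one] at this
  exact ne_top_of_le_ne_top hC this

/-! ### Minimax by Hahn-Banach and Riesz. -/

/-- Separate `K` from the open convex set of functions exceeding `M` everywhere. The separating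
functional, divided by its value at `1`, is positive and normalised, hence integration against a
probability measure. -/
theorem exists_isProbabilityMeasure_of_convex {X : Type*} [TopologicalSpace X] [CompactSpace X]
    [T2Space X] [MeasurableSpace X] [BorelSpace X] {K : Set C(X, ℝ)} (hK : Convex ℝ K)
    (h0 : 0 ∈ K) {M : ℝ} (h : ∀ φ ∈ K, ∃ x, φ x ≤ M) :
    ∃ μ : Measure X, IsProbabilityMeasure μ ∧ ∀ φ ∈ K, ∫ x, φ x ∂μ ≤ M := by
  let U : Set C(X, ℝ) := {φ | ∀ x, M < φ x}
  have hUo : IsOpen U := by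
    have : U = {φ : C(X, ℝ) | MapsTo φ univ (Ioi M)} := by
      ext φ; simp [U, MapsTo]
    rw [this]
    exact ContinuousMap.isOpen_setOfPred_mapsTo isCompact_univ isOpen_Ioi
  have hUc : Convex ℝ U := by
    intro φ hφ ψ hψ a b ha hb hab x
    exact (convex_Ioi M) (hφ x) (hψ x) ha hb hab
  have hd : Disjoint U K := by
    rw [Set.disjoint_left]
    intro φ hφ hφK
    obtain ⟨x, hx⟩ := h φ hφK
    exact absurd (hφ x) (not_lt.2 hx)
  obtain ⟨Λ, s, hU, hKs⟩ := geometric_hahn_banach_open hUc hUo hK hd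
  have hs : s ≤ 0 := by simpa using hKs 0 h0
  have hone : ∀ c, M < c → c * Λ 1 < s := by
    intro c hc
    have := hU (c • 1) (fun x => by simpa using hc)
    simpa using this
  have hpos : ∀ φ : C(X, ℝ), (∀ x, 0 ≤ φ x) → Λ φ ≤ 0 := by
    intro φ hφ
    by_contra! hcon
    -- `U` is stable under adding nonnegative functions, so `Λ φ > 0` would make `Λ` unbounded above
    -- on `U`.
    have key : ∀ t : ℝ, 0 ≤ t → (M + 1) * Λ 1 + t * Λ φ < s := by
      intro t ht
      have := hU ((M + 1) • 1 + t • φ) (fun x => by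
        have := mul_nonneg ht (hφ x)
        simp; linarith)
      simpa using this
    have h2 := key (|s - (M + 1) * Λ 1| / Λ φ) (by positivity)
    rw [div_mul_cancel₀ _ hcon.ne'] at h2
    linarith [le_abs_self (s - (M + 1) * Λ 1)]
  -- Here `0 ∈ K` is essential: it gives `s ≤ 0`, which excludes `Λ 1 = 0`.
  have hΛ1 : Λ 1 < 0 := by
    refine lt_of_le_of_ne (hpos 1 fun x => zero_le_one) fun h1 => ?_
    have := hone (M + 1) (by linarith)
    rw [h1] at this
    linarith
  have hM : M * Λ 1 ≤ s := by
    refine le_of_forall_pos_le_add fun ε hε => ?_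
    have := hone (M + ε / (-Λ 1)) (by linarith [div_pos hε (neg_pos.2 hΛ1)])
    have e : ε / (-Λ 1) * Λ 1 = -ε := by
      have := hΛ1.ne
      field_simp
    rw [add_mul, e] at this
    linarith
  let T : CompactlySupportedContinuousMap X ℝ →ₚ[ℝ] ℝ := PositiveLinearMap.mk₀
    { toFun := fun φ => (Λ 1)⁻¹ * Λ φ.toContinuousMap
      map_add' := fun φ ψ => by
        rw [← mul_add, ← map_add]; rfl
      map_smul' := fun c φ => by
        have : (c • φ).toContinuousMap = c • φ.toContinuousMap := rfl
        rw [this, map_smul]; simp; ring }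
    (fun φ hφ => mul_nonneg_of_nonpos_of_nonpos (inv_nonpos.2 hΛ1.le)
      (hpos _ fun x => hφ x))
  have hint : ∀ φ : C(X, ℝ), ∫ x, φ x ∂(RealRMK.rieszMeasure T) = (Λ 1)⁻¹ * Λ φ := fun φ =>
    RealRMK.integral_rieszMeasure T (CompactlySupportedContinuousMap.continuousMapEquiv φ)
  refine ⟨RealRMK.rieszMeasure T, ?_, fun φ hφ => ?_⟩
  · have h1 := hint 1
    rw [inv_mul_cancel₀ hΛ1.ne] at h1
    simp only [ContinuousMap.one_apply, integral_const, smul_eq_mul, mul_one] at h1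
    exact ⟨(ENNReal.toReal_eq_one_iff _).1 h1⟩
  · rw [hint]
    have := mul_le_mul_of_nonpos_left (hM.trans (hKs φ hφ)) (inv_nonpos.2 hΛ1.le)
    rwa [mul_comm M, inv_mul_cancel_left₀ hΛ1.ne] at this

theorem Continuous.integrable_of_compactSpace {X F : Type*} [TopologicalSpace X] [CompactSpace X]
    [MeasurableSpace X] [OpensMeasurableSpace X] [NormedAddCommGroup F] {μ : Measure X}
    [IsFiniteMeasure μ] {f : X → F} (hf : Continuous f) : Integrable f μ :=
  hf.integrable_of_hasCompactSupport (HasCompactSupport.of_compactSpace f)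

/-! ### Logarithmic potentials, energy and capacity. -/

section Potential

variable {E : Set ℂ}

/-- The analytic completion of the logarithmic potential of a measure on the circle. -/
noncomputable def analyticPotential (μ : Measure E) (z : ℂ) : ℂ :=
  ∫ w : E, (Real.log 2 - Complex.log (1 - z * (starRingEnd ℂ) w)) ∂μ

/-- The Taylor coefficients of the analytic potential. -/
noncomputable def potentialCoeff (μ : Measure E) (k : ℕ) : ℂ :=
  (if k = 0 then (Real.log 2 : ℂ) else 0) + (∫ w : E, (starRingEnd ℂ) (w : ℂ) ^ k ∂μ) / k

theorem one_sub_mem_slitPlane {z : ℂ} (hz : ‖z‖ < 1) : 1 - z ∈ Complex.slitPlane := by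
  simpa [sub_eq_add_neg] using Complex.mem_slitPlane_of_norm_lt_one (z := -z) (by simpa using hz)

/-- Integrate the series of `-log (1 - z w̄)` term by term. At `k = 0` the convention `x / 0 = 0`
removes the moment term, leaving `log 2`. -/
theorem hasSum_analyticPotential [CompactSpace E] (hE : E ⊆ sphere 0 1) (μ : Measure E) [IsProbabilityMeasure μ]
    {z : ℂ} (hz : z ∈ ball (0 : ℂ) 1) :
    HasSum (fun k => potentialCoeff μ k * z ^ k) (analyticPotential μ z) := by
  rw [mem_ball_zero_iff] at hz
  have hn : ∀ w : E, ‖z * (starRingEnd ℂ) w‖ = ‖z‖ := fun w => by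
    rw [norm_mul, RCLike.norm_conj, mem_sphere_zero_iff_norm.1 (hE w.2), mul_one]
  let F : ℕ → E → ℂ := fun k w => (if k = 0 then (Real.log 2 : ℂ) else 0) +
    (z * (starRingEnd ℂ) w) ^ k / k
  have hFs : ∀ w : E, HasSum (fun k => F k w)
      (Real.log 2 - Complex.log (1 - z * (starRingEnd ℂ) w)) := by
    intro w
    rw [sub_eq_add_neg]
    exact (hasSum_ite_eq 0 _).add (Complex.hasSum_taylorSeries_neg_log (by rwa [hn]))
  have hFc : ∀ k, Continuous (F k) := fun k => by fun_prop
  have hbound : ∀ k w, ‖F k w‖ ≤ (if k = 0 then Real.log 2 else 0) + ‖z‖ ^ k := by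
    intro k w
    refine (norm_add_le _ _).trans (add_le_add ?_ ?_)
    · split_ifs
      · rw [Complex.norm_real, Real.norm_of_nonneg (Real.log_nonneg one_le_two)]
      · simp
    · rw [norm_div, norm_pow, hn, Complex.norm_natCast]
      rcases Nat.eq_zero_or_pos k with rfl | hk
      · simp
      · exact div_le_self (by positivity) (by exact_mod_cast hk)
  have h := hasSum_integral_of_summable_integral_norm (μ := μ) (F := F)
    (fun k => (hFc k).integrable_of_compactSpace) (by
      refine Summable.of_nonneg_of_le (fun k => integral_nonneg fun _ => norm_nonneg _)
        (fun k => ?_) ((hasSum_ite_eq 0 (Real.log 2)).summable.add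
          (summable_geometric_of_lt_one (norm_nonneg z) hz))
      refine (integral_mono (hFc k).norm.integrable_of_compactSpace (integrable_const _)
        (hbound k)).trans_eq ?_
      simp)
  have e : (∫ w, ∑' k, F k w ∂μ) = analyticPotential μ z := by
    refine integral_congr_ae (Eventually.of_forall fun w => (hFs w).tsum_eq)
  rw [e] at h
  refine h.congr_fun fun k => ?_
  rw [integral_add (integrable_const _) (Continuous.integrable_of_compactSpace (by fun_prop))]
  simp only [potentialCoeff, integral_const, probReal_univ, one_smul, mul_pow, add_mul]
  congr 1
  · split_ifs with hk
    · simp [hk]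
    · simp
  · rw [integral_div, integral_const_mul]
    ring

theorem differentiableOn_analyticPotential [CompactSpace E] (hE : E ⊆ sphere 0 1) (μ : Measure E)
    [IsProbabilityMeasure μ] : DifferentiableOn ℂ (analyticPotential μ) (ball 0 1) :=
  differentiableOn_of_hasSum fun _ hz => hasSum_analyticPotential hE μ hz

theorem integrable_log_kernel [CompactSpace E] (hE : E ⊆ sphere 0 1) (μ : Measure E) [IsProbabilityMeasure μ]
    {z : ℂ} (hz : z ∈ ball (0 : ℂ) 1) :
    Integrable (fun w : E => (Real.log 2 - Complex.log (1 - z * (starRingEnd ℂ) w) : ℂ)) μ := by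
  rw [mem_ball_zero_iff] at hz
  refine Continuous.integrable_of_compactSpace ?_
  refine continuous_const.sub (Continuous.clog (by fun_prop) fun w => one_sub_mem_slitPlane ?_)
  rwa [norm_mul, RCLike.norm_conj, mem_sphere_zero_iff_norm.1 (hE w.2), mul_one]

theorem re_log_kernel_nonneg (hE : E ⊆ sphere 0 1) {z : ℂ} (hz : z ∈ ball (0 : ℂ) 1) (w : E) :
    0 ≤ (Real.log 2 - Complex.log (1 - z * (starRingEnd ℂ) w) : ℂ).re := by
  rw [mem_ball_zero_iff] at hz
  have hn : ‖z * (starRingEnd ℂ) w‖ < 1 := by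
    rwa [norm_mul, RCLike.norm_conj, mem_sphere_zero_iff_norm.1 (hE w.2), mul_one]
  rw [Complex.sub_re, Complex.ofReal_re, Complex.log_re, sub_nonneg]
  have h0 : (1 - z * (starRingEnd ℂ) w) ≠ 0 := Complex.slitPlane_ne_zero (one_sub_mem_slitPlane hn)
  refine Real.log_le_log (norm_pos_iff.2 h0) ?_
  refine (norm_sub_le _ _).trans ?_
  rw [norm_one]; linarith

theorem re_analyticPotential [CompactSpace E] (hE : E ⊆ sphere 0 1) (μ : Measure E) [IsProbabilityMeasure μ]
    {z : ℂ} (hz : z ∈ ball (0 : ℂ) 1) :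
    (analyticPotential μ z).re =
      ∫ w : E, (Real.log 2 - Complex.log (1 - z * (starRingEnd ℂ) w) : ℂ).re ∂μ :=
  (integral_re (integrable_log_kernel hE μ hz)).symm

/-- Integrating `z ^ k` against `μ` gives the conjugate of the `k`-th moment, so the energy of the
dilated potential is a series of nonnegative terms. -/
theorem hasSum_integral_re_analyticPotential [CompactSpace E] (hE : E ⊆ sphere 0 1) (μ : Measure E)
    [IsProbabilityMeasure μ] {r : ℝ} (hr0 : 0 ≤ r) (hr : r < 1) :
    HasSum (fun k : ℕ => (if k = 0 then Real.log 2 else 0) +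
        r ^ k * ‖∫ w : E, (starRingEnd ℂ) (w : ℂ) ^ k ∂μ‖ ^ 2 / k)
      (∫ z : E, (analyticPotential μ (r * z)).re ∂μ) := by
  have hn : ∀ z : E, ‖(r * z : ℂ)‖ = r := fun w => by
    rw [norm_mul, mem_sphere_zero_iff_norm.1 (hE w.2), mul_one, Complex.norm_real,
      Real.norm_of_nonneg hr0]
  have hmem : ∀ z : E, (r * z : ℂ) ∈ ball (0 : ℂ) 1 := fun z => by
    rw [mem_ball_zero_iff, hn]; exact hr
  have hrmem : (r : ℂ) ∈ ball (0 : ℂ) 1 := by simpa [abs_of_nonneg hr0] using hr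
  have hc : Continuous fun z : E => analyticPotential μ (r * z) :=
    (differentiableOn_analyticPotential hE μ).continuousOn.comp_continuous (by fun_prop) hmem
  have h := hasSum_integral_of_summable_integral_norm (μ := μ)
    (F := fun k (z : E) => potentialCoeff μ k * (r * z) ^ k)
    (fun k => Continuous.integrable_of_compactSpace (by fun_prop)) (by
      refine (hasSum_analyticPotential hE μ hrmem).summable.norm.congr fun k => ?_
      simp only [norm_mul, norm_pow, mem_sphere_zero_iff_norm.1 (hE (Subtype.coe_prop _))]
      simp)
  have e : (∫ z : E, ∑' k, potentialCoeff μ k * (r * z) ^ k ∂μ) =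
      ∫ z : E, analyticPotential μ (r * z) ∂μ :=
    integral_congr_ae (Eventually.of_forall fun z =>
      (hasSum_analyticPotential hE μ (hmem z)).tsum_eq)
  rw [e] at h
  have hre := Complex.hasSum_re h
  have e2 : (∫ z : E, (analyticPotential μ (r * z)).re ∂μ) =
      (∫ z : E, analyticPotential μ (r * z) ∂μ).re := integral_re hc.integrable_of_compactSpace
  rw [e2]
  refine hre.congr_fun fun k => ?_
  rw [integral_const_mul]
  simp only [mul_pow]
  rw [integral_const_mul]
  set m := ∫ w : E, (starRingEnd ℂ) (w : ℂ) ^ k ∂μ with hm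
  have e3 : ∫ w : E, (w : ℂ) ^ k ∂μ = (starRingEnd ℂ) m := by
    rw [hm, ← integral_conj]; simp
  rw [e3, potentialCoeff, ← hm]
  rcases eq_or_ne k 0 with rfl | hk
  · have : m = 1 := by simp [hm]
    rw [this]
    simp only [if_true, Nat.cast_zero, div_zero, add_zero, pow_zero, mul_one, map_one,
      Complex.ofReal_re]
  · have e4 : (0 + m / k) * ((r : ℂ) ^ k * (starRingEnd ℂ) m) = ((r ^ k * ‖m‖ ^ 2 / k : ℝ) : ℂ) := by
      push_cast
      rw [← Complex.mul_conj']
      ring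
    rw [if_neg hk, if_neg hk, e4, Complex.ofReal_re, zero_add]

/-- Term by term against the energy series: `(k+1)/k ≤ 2` and `r ^ (2k) ≤ r ^ k` for `k ≥ 1`, while
`(log 2)² ≤ 2 log 2` at `k = 0`. -/
theorem dirichletSum_analyticPotential_le [CompactSpace E] (hE : E ⊆ sphere 0 1) (μ : Measure E)
    [IsProbabilityMeasure μ] {r : ℝ} (hr0 : 0 ≤ r) (hr : r < 1) :
    dirichletSum (fun z => analyticPotential μ (r * z)) ≤
      ENNReal.ofReal (2 * ∫ z : E, (analyticPotential μ (r * z)).re ∂μ) := by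
  have ht : taylorCoeff (fun z => analyticPotential μ (r * z)) =
      fun k => potentialCoeff μ k * r ^ k := by
    refine taylorCoeff_eq_of_hasSum fun z hz => ?_
    refine (hasSum_analyticPotential hE μ (z := r * z) ?_).congr_fun fun k => by ring
    rw [mem_ball_zero_iff] at hz ⊢
    rw [norm_mul, Complex.norm_real, Real.norm_of_nonneg hr0]
    nlinarith [norm_nonneg z]
  have hs := (hasSum_integral_re_analyticPotential hE μ hr0 hr).mul_left 2
  rw [← hs.tsum_eq, ENNReal.ofReal_tsum_of_nonneg _ hs.summable, dirichletSum, ht]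
  · refine ENNReal.tsum_le_tsum fun k => ?_
    have e : ∀ z : ℂ, ((k : ℝ≥0∞) + 1) * ‖z‖ₑ ^ 2 = ENNReal.ofReal ((k + 1) * ‖z‖ ^ 2) :=
      fun z => by
        rw [ENNReal.ofReal_mul (by positivity), ENNReal.ofReal_pow (norm_nonneg _), ofReal_norm,
          ENNReal.ofReal_add (by positivity) zero_le_one]
        simp
    rw [e]
    refine ENNReal.ofReal_le_ofReal ?_
    set m := ∫ w : E, (starRingEnd ℂ) (w : ℂ) ^ k ∂μ with hm
    have hl0 : 0 ≤ Real.log 2 := Real.log_nonneg one_le_two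
    rcases Nat.eq_zero_or_pos k with rfl | hk
    · simp only [potentialCoeff, if_true, Nat.cast_zero, div_zero, add_zero, pow_zero, mul_one,
        zero_add, one_mul, Complex.norm_real, Real.norm_of_nonneg hl0]
      nlinarith [Real.log_two_lt_d9]
    · simp only [potentialCoeff]
      rw [if_neg hk.ne', if_neg hk.ne', ← hm]
      have hk1 : (1 : ℝ) ≤ k := by exact_mod_cast hk
      have hrk : r ^ k ≤ 1 := pow_le_one₀ hr0 hr.le
      have hrk0 : 0 ≤ r ^ k := by positivity
      rw [zero_add, zero_add, norm_mul, norm_div, Complex.norm_natCast, norm_pow,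
        Complex.norm_real, Real.norm_of_nonneg hr0]
      have : ((k : ℝ) + 1) * (‖m‖ / k * r ^ k) ^ 2 =
          (r ^ k * ‖m‖ ^ 2 / k) * (((k + 1) / k) * r ^ k) := by
        field_simp
      rw [this, mul_comm 2]
      gcongr
      have h2 : ((k : ℝ) + 1) / k ≤ 2 := by
        rw [div_le_iff₀ (by positivity)]; linarith
      nlinarith [div_nonneg (by positivity : (0:ℝ) ≤ (k : ℝ) + 1) (by positivity : (0:ℝ) ≤ k)]
  · intro k
    have hl0 : 0 ≤ Real.log 2 := Real.log_nonneg one_le_two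
    split_ifs <;> positivity

/-- On the circle `|1 - z w̄| = |z - w|`, so the dilated kernels tend to the logarithmic one,
diagonal included. They are nonnegative, so Fatou applies in each variable. -/
theorem logEnergy_map_le [CompactSpace E] (hE : E ⊆ sphere 0 1) (μ : Measure E) [IsProbabilityMeasure μ] {C : ℝ}
    (hC : ∀ r : ℝ, 0 ≤ r → r < 1 → ∫ z : E, (analyticPotential μ (r * z)).re ∂μ ≤ C)
    (hEm : MeasurableSet E) :
    logEnergy (μ.map (fun z : E => (z : ℂ))) ≤ ENNReal.ofReal C := by
  obtain ⟨r, hr1, hr2⟩ : ∃ r : ℕ → ℝ, (∀ n, 0 ≤ r n ∧ r n < 1) ∧ Tendsto r atTop (𝓝 1) := by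
    refine ⟨fun n => 1 - 1 / ((n : ℝ) + 1), fun n => ⟨?_, ?_⟩, ?_⟩
    · rw [sub_nonneg, div_le_one (by positivity)]; linarith [n.cast_nonneg (α := ℝ)]
    · have : 0 < 1 / ((n : ℝ) + 1) := by positivity
      linarith
    · simpa using tendsto_const_nhds.sub (tendsto_one_div_add_atTop_nhds_zero_nat (𝕜 := ℝ))
  have hn : ∀ n, ∀ z : E, ‖(r n * z : ℂ)‖ = r n := fun n w => by
    rw [norm_mul, mem_sphere_zero_iff_norm.1 (hE w.2), mul_one, Complex.norm_real,
      Real.norm_of_nonneg (hr1 n).1]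
  have hmem : ∀ n, ∀ z : E, (r n * z : ℂ) ∈ ball (0 : ℂ) 1 := fun n z => by
    rw [mem_ball_zero_iff, hn]; exact (hr1 n).2
  let k : ℕ → E → E → ℝ := fun n z w =>
    (Real.log 2 - Complex.log (1 - r n * z * (starRingEnd ℂ) (w : ℂ)) : ℂ).re
  have hk0 : ∀ n z w, 0 ≤ k n z w := fun n z w => re_log_kernel_nonneg hE (hmem n z) w
  have hkc : ∀ n z, Continuous (k n z) := by
    intro n z
    refine Complex.continuous_re.comp (continuous_const.sub
      (Continuous.clog (by fun_prop) fun w => one_sub_mem_slitPlane ?_))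
    rw [norm_mul, RCLike.norm_conj, mem_sphere_zero_iff_norm.1 (hE w.2), mul_one, hn]
    exact (hr1 n).2
  have hlim : ∀ z w : E, logKernel z w ≤ liminf (fun n => ENNReal.ofReal (k n z w)) atTop := by
    intro z w
    have hz : ‖(z : ℂ)‖ = 1 := mem_sphere_zero_iff_norm.1 (hE z.2)
    have hw : ‖(w : ℂ)‖ = 1 := mem_sphere_zero_iff_norm.1 (hE w.2)
    have hww : (w : ℂ) * (starRingEnd ℂ) (w : ℂ) = 1 := by
      rw [Complex.mul_conj, Complex.normSq_eq_norm_sq, hw]; simp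
    have hkn : ∀ n, k n z w =
        Real.log 2 - Real.log ‖1 - (r n : ℂ) * z * (starRingEnd ℂ) (w : ℂ)‖ := fun n => by
      simp only [k]
      rw [Complex.sub_re, Complex.ofReal_re, Complex.log_re]
    have hnorm : Tendsto (fun n => ‖1 - (r n : ℂ) * z * (starRingEnd ℂ) (w : ℂ)‖) atTop
        (𝓝 ‖(z : ℂ) - w‖) := by
      have h1 : ‖(z : ℂ) - w‖ = ‖1 - ((1 : ℝ) : ℂ) * z * (starRingEnd ℂ) (w : ℂ)‖ := by
        calc ‖(z : ℂ) - w‖ = ‖(w : ℂ) - z‖ * ‖(starRingEnd ℂ) (w : ℂ)‖ := by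
              rw [norm_sub_rev, RCLike.norm_conj, hw, mul_one]
          _ = _ := by
              rw [← norm_mul, sub_mul, hww, Complex.ofReal_one, one_mul]
      rw [h1]
      have hc : Continuous fun t : ℝ => ‖1 - (t : ℂ) * z * (starRingEnd ℂ) (w : ℂ)‖ := by fun_prop
      exact (hc.tendsto 1).comp hr2
    have hT : Tendsto (fun n => ENNReal.ofReal (k n z w)) atTop (𝓝 (logKernel z w)) := by
      simp only [hkn]
      by_cases h : (z : ℂ) = w
      · rw [logKernel, if_pos h]
        refine ENNReal.tendsto_ofReal_atTop.comp ?_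
        rw [h, sub_self, norm_zero] at hnorm
        have hpos : ∀ n, 0 < ‖1 - (r n : ℂ) * z * (starRingEnd ℂ) (w : ℂ)‖ := fun n => by
          refine norm_pos_iff.2 (Complex.slitPlane_ne_zero (one_sub_mem_slitPlane ?_))
          rw [norm_mul, RCLike.norm_conj, hw, mul_one, hn]
          exact (hr1 n).2
        have h2 : Tendsto (fun n => ‖1 - (r n : ℂ) * z * (starRingEnd ℂ) (w : ℂ)‖) atTop (𝓝[>] 0) :=
          tendsto_nhdsWithin_iff.2 ⟨by simpa only [h] using hnorm, Eventually.of_forall hpos⟩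
        exact tendsto_atTop_add_const_left _ _
          (tendsto_neg_atBot_atTop.comp (Real.tendsto_log_nhdsGT_zero.comp h2))
      · have hne : ‖(z : ℂ) - w‖ ≠ 0 := norm_ne_zero_iff.2 (sub_ne_zero.2 h)
        rw [logKernel, if_neg h, Real.log_div two_ne_zero hne]
        exact (ENNReal.continuous_ofReal.tendsto _).comp
          (tendsto_const_nhds.sub ((Real.continuousAt_log hne).tendsto.comp hnorm))
    exact hT.liminf_eq.ge
  have hemb : MeasurableEmbedding (fun z : E => (z : ℂ)) := MeasurableEmbedding.subtype_coe hEm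
  rw [logEnergy, hemb.lintegral_map]
  simp only [hemb.lintegral_map]
  have hin : ∀ n z, ∫⁻ w, ENNReal.ofReal (k n z w) ∂μ =
      ENNReal.ofReal (analyticPotential μ (r n * z)).re := by
    intro n z
    rw [← ofReal_integral_eq_lintegral_ofReal (hkc n z).integrable_of_compactSpace
      (Eventually.of_forall (hk0 n z)), re_analyticPotential hE μ (hmem n z)]
  have hc : ∀ n, Continuous fun z : E => (analyticPotential μ (r n * z)).re := fun n =>
    Complex.continuous_re.comp
    ((differentiableOn_analyticPotential hE μ).continuousOn.comp_continuous (by fun_prop) (hmem n))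
  calc ∫⁻ z : E, ∫⁻ w : E, logKernel z w ∂μ ∂μ
      ≤ ∫⁻ z : E, liminf (fun n => ENNReal.ofReal (analyticPotential μ (r n * z)).re) atTop ∂μ := by
        refine lintegral_mono fun z => ?_
        refine (lintegral_mono (hlim z)).trans ?_
        refine (lintegral_liminf_le fun n => (hkc n z).measurable.ennreal_ofReal).trans_eq ?_
        simp only [hin]
    _ ≤ liminf (fun n => ∫⁻ z : E, ENNReal.ofReal (analyticPotential μ (r n * z)).re ∂μ) atTop :=
        lintegral_liminf_le fun n => (hc n).measurable.ennreal_ofReal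
    _ ≤ ENNReal.ofReal C := by
        refine liminf_le_of_le (by isBoundedDefault) fun b hb => ?_
        obtain ⟨n, hn⟩ := hb.exists
        refine hn.trans ?_
        rw [← ofReal_integral_eq_lintegral_ofReal (hc n).integrable_of_compactSpace]
        · exact ENNReal.ofReal_le_ofReal (hC _ (hr1 n).1 (hr1 n).2)
        · refine Eventually.of_forall fun z => ?_
          exact (integral_nonneg (hk0 n z)).trans_eq (re_analyticPotential hE μ (hmem n z)).symm

/-- Dual to the definition of capacity: if no such `u` existed, the measure supplied by the minimax
lemma would have energy at most `2 M ^ 2`. -/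
theorem exists_analytic_of_logCapacity_eq_zero (hEc : IsClosed E) (hE : E ⊆ sphere 0 1)
    (hcap : logCapacity E = 0) (M : ℝ) :
    ∃ u : ℂ → ℂ, AnalyticOnNhd ℂ u (closedBall 0 1) ∧ (∀ z ∈ closedBall (0 : ℂ) 1, 0 ≤ (u z).re) ∧
      dirichletSum u ≤ 1 ∧ ∀ z ∈ E, M < (u z).re := by
  have hcomp : CompactSpace E := isCompact_iff_compactSpace.1
    ((isCompact_sphere (0 : ℂ) 1).of_isClosed_subset hEc hE)
  by_contra! hcon
  let K : Set C(E, ℝ) := {φ | ∃ u : ℂ → ℂ, AnalyticOnNhd ℂ u (closedBall 0 1) ∧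
    (∀ z ∈ closedBall (0 : ℂ) 1, 0 ≤ (u z).re) ∧ dirichletSum u ≤ 1 ∧ ∀ z : E, φ z = (u z).re}
  have hK : Convex ℝ K := by
    rintro φ ⟨u, hu, hu0, hu1, huφ⟩ ψ ⟨v, hv, hv0, hv1, hvψ⟩ a b ha hb hab
    refine ⟨fun z => a * u z + b * v z, fun z hz => ?_, fun z hz => ?_, ?_, fun z => ?_⟩
    · exact (analyticAt_const.mul (hu z hz)).add (analyticAt_const.mul (hv z hz))
    · simpa using add_nonneg (mul_nonneg ha (hu0 z hz)) (mul_nonneg hb (hv0 z hz))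
    · refine (dirichletSum_convex hu.differentiableOn_ball hv.differentiableOn_ball ha hb
        hab).trans ?_
      calc _ ≤ ENNReal.ofReal a * 1 + ENNReal.ofReal b * 1 := by gcongr
        _ = 1 := by rw [mul_one, mul_one, ← ENNReal.ofReal_add ha hb, hab, ENNReal.ofReal_one]
    · simp [huφ, hvψ]
  obtain ⟨μ, hμ, hμK⟩ := exists_isProbabilityMeasure_of_convex (M := M) hK
    ⟨fun _ => 0, analyticOnNhd_const, by simp, by
      have := dirichletSum_const_mul (f := fun _ => 1) (differentiableOn_const _) 0
      simp only [zero_mul, enorm_zero] at this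
      rw [this]; simp, by simp⟩ (by
    rintro φ ⟨u, hu, hu0, hu1, huφ⟩
    obtain ⟨z, hz, hzM⟩ := hcon u hu hu0 hu1
    exact ⟨⟨z, hz⟩, (huφ _).trans_le hzM⟩)
  have hbound : ∀ r : ℝ, 0 ≤ r → r < 1 →
      ∫ z : E, (analyticPotential μ (r * z)).re ∂μ ≤ 2 * M ^ 2 := by
    intro r hr0 hr
    set J := ∫ z : E, (analyticPotential μ (r * z)).re ∂μ with hJ
    by_cases hJ0 : J ≤ 0
    · exact hJ0.trans (by positivity)
    rw [not_le] at hJ0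
    have hmem : ∀ z ∈ closedBall (0 : ℂ) 1, (r * z : ℂ) ∈ ball (0 : ℂ) 1 := fun z hz => by
      rw [mem_closedBall_zero_iff] at hz
      rw [mem_ball_zero_iff, norm_mul, Complex.norm_real, Real.norm_of_nonneg hr0]
      nlinarith [norm_nonneg z]
    have hd := differentiableOn_analyticPotential hE μ
    have han : AnalyticOnNhd ℂ (fun z => analyticPotential μ (r * z)) (closedBall 0 1) :=
      fun z hz => (hd.analyticAt (isOpen_ball.mem_nhds (hmem z hz))).comp
        (f := fun z : ℂ => (r : ℂ) * z) (analyticAt_const.mul analyticAt_id)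
    -- This scaling makes the squared norm at most `l² · 2J = 1`; then `l J ≤ M` squares to `J / 2 ≤
    -- M ^ 2`.
    set l : ℝ := (√(2 * J))⁻¹ with hl
    have hl0 : 0 < l := by positivity
    have hl2 : l ^ 2 * (2 * J) = 1 := by
      rw [hl, inv_pow, Real.sq_sqrt (by positivity)]
      field_simp
    have hcont : Continuous fun z : E => (l * (analyticPotential μ (r * z)).re) := by
      refine continuous_const.mul (Complex.continuous_re.comp ?_)
      exact hd.continuousOn.comp_continuous (by fun_prop)
        fun z => hmem z (sphere_subset_closedBall (hE z.2))
    have h1 := hμK ⟨_, hcont⟩ ⟨fun z => l * analyticPotential μ (r * z),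
      fun z hz => analyticAt_const.mul (han z hz), fun z hz => by
        rw [Complex.re_ofReal_mul, re_analyticPotential hE μ (hmem z hz)]
        exact mul_nonneg hl0.le (integral_nonneg fun w => re_log_kernel_nonneg hE (hmem z hz) w), by
        rw [dirichletSum_const_mul han.differentiableOn_ball]
        refine (mul_le_mul_right (dirichletSum_analyticPotential_le hE μ hr0 hr) _).trans_eq ?_
        rw [← hJ, ← ofReal_norm, Complex.norm_real, Real.norm_of_nonneg hl0.le,
          ← ENNReal.ofReal_pow hl0.le, ← ENNReal.ofReal_mul (by positivity), hl2,
          ENNReal.ofReal_one], fun z => by simp⟩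
    simp only [ContinuousMap.coe_mk] at h1
    rw [integral_const_mul, ← hJ] at h1
    have h2 : (l * J) ^ 2 ≤ M ^ 2 := pow_le_pow_left₀ (by positivity) h1 2
    nlinarith
  have henergy := logEnergy_map_le hE μ hbound hEc.measurableSet
  have hpm : IsProbabilityMeasure (μ.map (fun z : E => (z : ℂ))) :=
    Measure.isProbabilityMeasure_map (by fun_prop)
  have hcarr : μ.map (fun z : E => (z : ℂ)) Eᶜ = 0 := by
    rw [Measure.map_apply (by fun_prop) hEc.measurableSet.compl]
    simp
  rw [logCapacity, ENNReal.inv_eq_zero, iInf_eq_top] at hcap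
  have h3 := hcap (μ.map (fun z : E => (z : ℂ)))
  simp only [iInf_eq_top] at h3
  rw [h3 hpm hcarr] at henergy
  exact absurd henergy (not_le.2 ENNReal.ofReal_lt_top)

end Potential

/-! ### Exponentials and cut-off functions. -/

theorem norm_exp_sub_one_le_of_re_le {x : ℂ} {c : ℝ} (hc : 0 ≤ c) (hx : x.re ≤ c) :
    ‖Complex.exp x - 1‖ ≤ Real.exp c * ‖x‖ := by
  have := (convex_halfSpace_re_le c).norm_image_sub_le_of_norm_deriv_le (f := Complex.exp)
    (C := Real.exp c) (x := 0) (y := x) (fun z _ => Complex.differentiableAt_exp)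
    (fun z hz => by
      rw [Complex.deriv_exp, Complex.norm_exp]
      exact Real.exp_le_exp.2 hz) (by simpa using hc) hx
  simpa using this

/-- An upper bound on `Re q` alone suffices, since `|(exp q)'| = exp (Re q) |q'|`. -/
theorem dirichletSum_exp_sub_one_le {q : ℂ → ℂ} {c : ℝ} (hc : 0 ≤ c)
    (hq : DifferentiableOn ℂ q (ball 0 1)) (hre : ∀ z ∈ ball (0 : ℂ) 1, (q z).re ≤ c) :
    dirichletSum (fun z => Complex.exp (q z) - 1) ≤
      3 * ENNReal.ofReal (Real.exp c) ^ 2 * dirichletSum q := by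
  refine dirichletSum_le_of_norm_le ENNReal.ofReal_ne_top (hq.cexp.sub_const 1) hq ?_ fun z hz => ?_
  · rw [← ofReal_norm, ← ofReal_norm, ← ENNReal.ofReal_mul (by positivity)]
    exact ENNReal.ofReal_le_ofReal (norm_exp_sub_one_le_of_re_le hc (hre 0 (by simp)))
  · have hqz := hq.differentiableAt (isOpen_ball.mem_nhds hz)
    rw [deriv_sub_const_fun, deriv_cexp hqz, enorm_mul]
    gcongr
    rw [← ofReal_norm, Complex.norm_exp]
    exact ENNReal.ofReal_le_ofReal (Real.exp_le_exp.2 (hre z hz))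

/-- Multiplying by `z ^ (-1)` would create a pole; the backward shift `(h - h 0) / z` does not, and
on `E` it costs only `|h 0|`, which is small with the norm of `h`. The bound on the circle grows by
at most `1` per shift. -/
theorem exists_cutoff {E : Set ℂ} (hEc : IsClosed E) (hE : E ⊆ sphere 0 1)
    (hcap : logCapacity E = 0) (N : ℕ) {η : ℝ} (hη : 0 < η) :
    ∃ h : ℂ → ℂ, AnalyticOnNhd ℂ h (closedBall 0 1) ∧ dirichletSum h ≤ ENNReal.ofReal η ∧
      (∀ z ∈ E, ‖z ^ N * h z - 1‖ ≤ η) ∧ ∀ z ∈ sphere (0 : ℂ) 1, ‖h z‖ ≤ N + 2 := by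
  induction N generalizing η with
  | zero =>
    set ε : ℝ := √(η / 3) with hε
    have hε0 : 0 < ε := by positivity
    have hε2 : 3 * ε ^ 2 = η := by
      rw [hε, Real.sq_sqrt (by positivity)]; ring
    -- The level `-log η / ε` is what makes `|exp (-ε u)| ≤ η` on `E`.
    obtain ⟨u, hu, hu0, hu1, huE⟩ :=
      exists_analytic_of_logCapacity_eq_zero hEc hE hcap (-Real.log η / ε)
    have han : AnalyticOnNhd ℂ (fun z => (-ε : ℂ) * u z) (closedBall 0 1) :=
      fun z hz => analyticAt_const.mul (hu z hz)
    have hre : ∀ z ∈ closedBall (0 : ℂ) 1, ((-ε : ℂ) * u z).re ≤ 0 := fun z hz => by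
      have := mul_nonneg hε0.le (hu0 z hz)
      rw [← Complex.ofReal_neg, Complex.re_ofReal_mul]
      linarith
    have han2 : AnalyticOnNhd ℂ (fun z => Complex.exp ((-ε : ℂ) * u z) - 1) (closedBall 0 1) :=
      fun z hz => (han z hz).cexp.sub analyticAt_const
    refine ⟨fun z => (-1) * (Complex.exp ((-ε : ℂ) * u z) - 1),
      fun z hz => analyticAt_const.mul (han2 z hz), ?_, fun z hz => ?_, fun z hz => ?_⟩
    · rw [dirichletSum_const_mul han2.differentiableOn_ball]
      have h1 := dirichletSum_exp_sub_one_le le_rfl han.differentiableOn_ball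
        fun z hz => hre z (ball_subset_closedBall hz)
      rw [dirichletSum_const_mul hu.differentiableOn_ball] at h1
      simp only [enorm_neg, enorm_one, one_pow, one_mul, Real.exp_zero, ENNReal.ofReal_one,
        mul_one] at h1 ⊢
      refine h1.trans ?_
      calc 3 * (‖(ε : ℂ)‖ₑ ^ 2 * dirichletSum u) ≤ 3 * (‖(ε : ℂ)‖ₑ ^ 2 * 1) := by gcongr
        _ = ENNReal.ofReal η := by
          rw [← hε2, ENNReal.ofReal_mul (by norm_num), ENNReal.ofReal_pow hε0.le, ← ofReal_norm,
            Complex.norm_real, Real.norm_of_nonneg hε0.le]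
          simp
    · have e : z ^ 0 * (-1 * (Complex.exp (-ε * u z) - 1)) - 1 = -Complex.exp (-ε * u z) := by ring
      rw [e, norm_neg, Complex.norm_exp, ← Complex.ofReal_neg, Complex.re_ofReal_mul,
        ← Real.le_log_iff_exp_le hη]
      have := huE z hz
      rw [div_lt_iff₀ hε0] at this
      linarith
    · rw [norm_mul, norm_neg, norm_one, one_mul]
      refine (norm_sub_le _ _).trans ?_
      rw [Complex.norm_exp, norm_one]
      have := Real.exp_le_one_iff.2 (hre z (sphere_subset_closedBall hz))
      push_cast
      linarith
  | succ N ih =>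
    -- As `|h 0|²` is at most the new tolerance, its three entries give respectively the old error
    -- `≤ η / 2`, `|h 0| ≤ η / 2` and `|h 0| ≤ 1`.
    obtain ⟨h, han, hS, hhE, hb⟩ := ih (η := min (min (η / 2) ((η / 2) ^ 2)) 1) (by positivity)
    set δ := min (min (η / 2) ((η / 2) ^ 2)) 1 with hδ
    have hδ0 : 0 ≤ δ := by positivity
    have hδ1 : δ ≤ η / 2 := (min_le_left _ _).trans (min_le_left _ _)
    have hδ2 : δ ≤ (η / 2) ^ 2 := (min_le_left _ _).trans (min_le_right _ _)
    have hδ3 : δ ≤ 1 := min_le_right _ _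
    have h0 : ‖h 0‖ ^ 2 ≤ δ := by
      have := (enorm_apply_zero_sq_le_dirichletSum h).trans hS
      rw [← ofReal_norm, ← ENNReal.ofReal_pow (norm_nonneg _)] at this
      exact (ENNReal.ofReal_le_ofReal_iff hδ0).1 this
    have h01 : ‖h 0‖ ≤ η / 2 := abs_le_of_sq_le_sq' (h0.trans hδ2) (by positivity) |>.2
    have h02 : ‖h 0‖ ≤ 1 := abs_le_of_sq_le_sq' (h0.trans (by simpa using hδ3)) zero_le_one |>.2
    have hds : ∀ z ∈ sphere (0 : ℂ) 1, z * dslope h 0 z = h z - h 0 := fun z hz => by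
      simpa using sub_smul_dslope h 0 z
    refine ⟨dslope h 0, ?_, ?_, fun z hz => ?_, fun z hz => ?_⟩
    · obtain ⟨R, hR, hd⟩ := han.exists_ball
      exact ((Complex.differentiableOn_dslope (ball_mem_nhds 0 (by linarith))).2
        hd).analyticOnNhd_closedBall hR
    · refine (dirichletSum_dslope_le han.differentiableOn_ball).trans (hS.trans ?_)
      exact ENNReal.ofReal_le_ofReal (by linarith)
    · have hz1 := mem_sphere_zero_iff_norm.1 (hE hz)
      have e : z ^ (N + 1) * dslope h 0 z - 1 = (z ^ N * h z - 1) - z ^ N * h 0 := by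
        rw [pow_succ, mul_assoc, hds z (hE hz)]; ring
      rw [e]
      refine (norm_sub_le _ _).trans ?_
      rw [norm_mul, norm_pow, hz1, one_pow, one_mul]
      linarith [hhE z hz]
    · have hz1 := mem_sphere_zero_iff_norm.1 hz
      have e := congrArg norm (hds z hz)
      rw [norm_mul, hz1, one_mul] at e
      rw [e]
      refine (norm_sub_le _ _).trans ?_
      push_cast
      linarith [hb z hz]

/-! ### Laurent approximation and logarithms on null sets. -/

/-- Stone-Weierstrass for polynomials in `z` and `z̄`, with `z̄ = 1 / z` on the circle. -/
theorem exists_laurent_approx {E : Set ℂ} (hEc : IsCompact E) (hE : E ⊆ sphere 0 1) (ψ : C(E, ℂ))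
    {ε : ℝ} (hε : 0 < ε) :
    ∃ (N : ℕ) (P : Polynomial ℂ), ∀ z : E, ‖P.eval (z : ℂ) / (z : ℂ) ^ N - ψ z‖ < ε := by
  have hcomp : CompactSpace E := isCompact_iff_compactSpace.1 hEc
  have hE0 : ∀ z : E, (z : ℂ) ≠ 0 := fun z =>
    norm_ne_zero_iff.1 (by simp [mem_sphere_zero_iff_norm.1 (hE z.2)])
  have hdense := polynomialFunctions.starClosure_topologicalClosure (𝕜 := ℂ) E
  have hψ : ψ ∈ (polynomialFunctions E).starClosure.topologicalClosure := by rw [hdense]; trivial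
  rw [← SetLike.mem_coe, StarSubalgebra.topologicalClosure_coe, Metric.mem_closure_iff] at hψ
  obtain ⟨φ, hφ, hφψ⟩ := hψ ε hε
  have key : ∀ φ ∈ (polynomialFunctions E).starClosure, ∃ (N : ℕ) (P : Polynomial ℂ),
      ∀ z : E, φ z * (z : ℂ) ^ N = P.eval (z : ℂ) := by
    intro φ hφ
    rw [polynomialFunctions.starClosure_eq_adjoin_X, ← StarSubalgebra.mem_toSubalgebra,
      StarAlgebra.adjoin_toSubalgebra] at hφ
    induction hφ using Algebra.adjoin_induction with
    | mem x hx =>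
      rcases hx with hx | hx
      · rw [mem_singleton_iff] at hx
        subst hx
        exact ⟨0, Polynomial.X, fun z => by simp⟩
      · rw [Set.mem_star, mem_singleton_iff] at hx
        refine ⟨1, 1, fun z => ?_⟩
        have h1 := congrArg (fun φ : C(E, ℂ) => φ z) hx
        simp only [ContinuousMap.star_apply] at h1
        have h2 : x z = (starRingEnd ℂ) (z : ℂ) := by
          rw [← star_star (x z), h1]; simp
        rw [h2, pow_one, mul_comm, Complex.mul_conj, Complex.normSq_eq_norm_sq,
          mem_sphere_zero_iff_norm.1 (hE z.2)]
        simp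
    | algebraMap c => exact ⟨0, Polynomial.C c, fun z => by simp⟩
    | add φ ψ _ _ h1 h2 =>
      obtain ⟨N, P, hP⟩ := h1
      obtain ⟨M, Q, hQ⟩ := h2
      refine ⟨N + M, P * Polynomial.X ^ M + Q * Polynomial.X ^ N, fun z => ?_⟩
      simp only [ContinuousMap.add_apply, Polynomial.eval_add, Polynomial.eval_mul,
        Polynomial.eval_pow, Polynomial.eval_X, ← hP, ← hQ]
      ring
    | mul φ ψ _ _ h1 h2 =>
      obtain ⟨N, P, hP⟩ := h1
      obtain ⟨M, Q, hQ⟩ := h2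
      refine ⟨N + M, P * Q, fun z => ?_⟩
      simp only [ContinuousMap.mul_apply, Polynomial.eval_mul, ← hP, ← hQ]
      ring
  obtain ⟨N, P, hP⟩ := key φ hφ
  refine ⟨N, P, fun z => ?_⟩
  rw [← hP, mul_div_cancel_right₀ _ (pow_ne_zero _ (hE0 z)), ← dist_eq_norm, dist_comm]
  exact (ContinuousMap.dist_apply_le_dist z).trans_lt hφψ

/-- Take `u` of norm at most `1` with `Re u > √n` on `E`: Parseval bounds the circle integral of
`|u|²` by `2π`, so the measure is at most `2π / n`. Parseval is available for radii below `1`,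
whence Fatou. -/
theorem volume_angles_eq_zero {E : Set ℂ} (hEc : IsClosed E) (hE : E ⊆ sphere 0 1)
    (hcap : logCapacity E = 0) :
    volume ({θ : ℝ | Complex.exp (θ * Complex.I) ∈ E} ∩ Ioc (-Real.pi) Real.pi) = 0 := by
  -- The circle integral uses the open interval, whereas `Complex.arg` takes values in the half-open
  -- one.
  rw [measure_congr ((ae_eq_refl _).inter Ioo_ae_eq_Ioc.symm)]
  set A : Set ℝ := {θ : ℝ | Complex.exp (θ * Complex.I) ∈ E} ∩ Ioo (-Real.pi) Real.pi with hA
  have hAm : MeasurableSet A :=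
    (hEc.preimage (by fun_prop : Continuous fun θ : ℝ => Complex.exp (θ * Complex.I))).measurableSet.inter
      measurableSet_Ioo
  have key : ∀ n : ℕ, (n : ℝ≥0∞) * volume A ≤ ENNReal.ofReal (2 * Real.pi) := by
    intro n
    obtain ⟨u, hu, hu0, hu1, huE⟩ :=
      exists_analytic_of_logCapacity_eq_zero hEc hE hcap (√n)
    obtain ⟨r, hr1, hr2⟩ : ∃ r : ℕ → ℝ, (∀ n, 0 ≤ r n ∧ r n < 1) ∧ Tendsto r atTop (𝓝 1) := by
      refine ⟨fun n => 1 - 1 / ((n : ℝ) + 1), fun n => ⟨?_, ?_⟩, ?_⟩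
      · rw [sub_nonneg, div_le_one (by positivity)]; linarith [n.cast_nonneg (α := ℝ)]
      · have : 0 < 1 / ((n : ℝ) + 1) := by positivity
        linarith
      · simpa using tendsto_const_nhds.sub (tendsto_one_div_add_atTop_nhds_zero_nat (𝕜 := ℝ))
    have hmem : ∀ m, ∀ θ : ℝ, (r m : ℂ) * Complex.exp (θ * Complex.I) ∈ closedBall (0 : ℂ) 1 :=
      fun m θ => by
        rw [mem_closedBall_zero_iff, norm_mul, Complex.norm_exp_ofReal_mul_I, Complex.norm_real,
          Real.norm_of_nonneg (hr1 m).1, mul_one]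
        exact (hr1 m).2.le
    have hle : ∀ m, ∫⁻ θ in A, ‖u (r m * Complex.exp (θ * Complex.I))‖ₑ ^ 2 ≤
        ENNReal.ofReal (2 * Real.pi) := by
      intro m
      refine (lintegral_mono_set inter_subset_right).trans ?_
      rw [lintegral_enorm_sq_circle hu.differentiableOn_ball (hr1 m).1 (hr1 m).2]
      refine mul_le_of_le_one_right' (le_trans ?_ hu1)
      refine ENNReal.tsum_le_tsum fun k => ?_
      rw [mul_comm]
      gcongr
      refine le_trans ?_ le_add_self
      rw [← ENNReal.ofReal_one]
      exact ENNReal.ofReal_le_ofReal (pow_le_one₀ (hr1 m).1 (hr1 m).2.le)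
    calc (n : ℝ≥0∞) * volume A = ∫⁻ θ in A, (n : ℝ≥0∞) := by simp
      _ ≤ ∫⁻ θ in A, liminf (fun m => ‖u (r m * Complex.exp (θ * Complex.I))‖ₑ ^ 2) atTop := by
        refine setLIntegral_mono' hAm fun θ hθ => ?_
        have hc : ContinuousAt u (Complex.exp (θ * Complex.I)) :=
          (hu _ (sphere_subset_closedBall (hE hθ.1))).continuousAt
        have h1 : Tendsto (fun m => (r m : ℂ) * Complex.exp (θ * Complex.I)) atTop
            (𝓝 (Complex.exp (θ * Complex.I))) := by
          simpa using ((Complex.continuous_ofReal.tendsto 1).comp hr2).mul_const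
            (Complex.exp (θ * Complex.I))
        have h2 : Tendsto (fun m => ‖u (r m * Complex.exp (θ * Complex.I))‖ₑ ^ 2) atTop
            (𝓝 (‖u (Complex.exp (θ * Complex.I))‖ₑ ^ 2)) :=
          ((ENNReal.continuous_pow 2).tendsto _).comp
            ((continuous_enorm.tendsto _).comp (hc.tendsto.comp h1))
        rw [h2.liminf_eq, ← ofReal_norm, ← ENNReal.ofReal_pow (norm_nonneg _),
          ← ENNReal.ofReal_natCast]
        refine ENNReal.ofReal_le_ofReal ?_
        have h3 := (huE _ hθ.1).le.trans ((le_abs_self _).trans (Complex.abs_re_le_norm _))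
        calc (n : ℝ) = √n ^ 2 := (Real.sq_sqrt (by positivity)).symm
          _ ≤ _ := by gcongr
      _ ≤ liminf (fun m => ∫⁻ θ in A, ‖u (r m * Complex.exp (θ * Complex.I))‖ₑ ^ 2) atTop := by
        refine lintegral_liminf_le fun m => ?_
        have : Continuous fun θ : ℝ => u (r m * Complex.exp (θ * Complex.I)) :=
          hu.continuousOn.comp_continuous (by fun_prop) (hmem m)
        exact this.measurable.enorm.pow_const 2
      _ ≤ _ := by
        refine liminf_le_of_le (by isBoundedDefault) fun b hb => ?_
        obtain ⟨m, hm⟩ := hb.exists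
        exact hm.trans (hle m)
  by_contra hne
  obtain ⟨n, hn⟩ := ENNReal.exists_nat_mul_gt hne (b := ENNReal.ofReal (2 * Real.pi))
    ENNReal.ofReal_ne_top
  exact absurd (key n) (not_le.2 hn)

/-- The union of the real lines through `0` and the points `F z`, `z ∈ E`, is the image of the null
set `ℝ × A` under a real-differentiable map of the plane, hence is null. -/
theorem exists_ray_avoided {E : Set ℂ} (hE : E ⊆ sphere 0 1)
    (hnull : volume ({θ : ℝ | Complex.exp (θ * Complex.I) ∈ E} ∩ Ioc (-Real.pi) Real.pi) = 0)
    {F : ℂ → ℂ} (hF : ∀ z ∈ sphere (0 : ℂ) 1, DifferentiableAt ℂ F z) :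
    ∃ c : ℂ, c ≠ 0 ∧ ∀ z ∈ E, ∀ t : ℝ, (t : ℂ) * F z ≠ c := by
  set A : Set ℝ := {θ : ℝ | Complex.exp (θ * Complex.I) ∈ E} ∩ Ioc (-Real.pi) Real.pi with hA
  set s : Set ℂ := {w | w.im ∈ A} with hs
  have hs0 : volume s = 0 := by
    have : s = Complex.measurableEquivRealProd ⁻¹' (univ ×ˢ A) := by
      ext w; simp [hs]
    rw [this, Complex.volume_preserving_equiv_real_prod.measure_preimage_equiv,
      Measure.volume_eq_prod, Measure.prod_prod, hnull, mul_zero]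
  let Φ : ℂ → ℂ := fun w => (w.re : ℂ) * F (Complex.exp (w.im * Complex.I))
  have hΦ : DifferentiableOn ℝ Φ s := by
    intro w hw
    refine DifferentiableAt.differentiableWithinAt ?_
    refine DifferentiableAt.mul ?_ ?_
    · exact Complex.ofRealCLM.differentiableAt.comp w Complex.reCLM.differentiableAt
    · have h1 := (hF _ (hE hw.1)).restrictScalars ℝ
      refine DifferentiableAt.comp (g := F) w h1 ?_
      refine DifferentiableAt.cexp (DifferentiableAt.mul_const ?_ _)
      exact Complex.ofRealCLM.differentiableAt.comp w Complex.imCLM.differentiableAt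
  have him : volume (Φ '' s) = 0 :=
    addHaar_image_eq_zero_of_differentiableOn_of_addHaar_eq_zero volume hΦ hs0
  have hun : volume (Φ '' s ∪ {0}) = 0 := measure_union_null him (measure_singleton 0)
  have hne : (Φ '' s ∪ {0}) ≠ univ := fun h => by
    rw [h] at hun
    exact NeZero.ne _ (Measure.measure_univ_eq_zero.1 hun)
  obtain ⟨c, hc⟩ := (ne_univ_iff_exists_notMem _).1 hne
  simp only [union_singleton, mem_insert_iff, not_or] at hc
  refine ⟨c, hc.1, fun z hz t htc => hc.2 ⟨t + Complex.arg z * Complex.I, ?_, ?_⟩⟩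
  all_goals
    have hz1 : Complex.exp (Complex.arg z * Complex.I) = z := by
      have := Complex.norm_mul_exp_arg_mul_I z
      rwa [mem_sphere_zero_iff_norm.1 (hE hz), Complex.ofReal_one, one_mul] at this
  · have : (t + Complex.arg z * Complex.I : ℂ).im = Complex.arg z := by simp
    simp only [hs, mem_ofPred_eq, this]
    exact ⟨by simpa [hz1] using hz, Complex.arg_mem_Ioc z⟩
  · simp [Φ, hz1, htc]

/-- Rotating by `-1 / c` moves the avoided direction to the negative axis, the cut of the principal
logarithm. -/
theorem exists_continuous_log {X : Type*} [TopologicalSpace X] (φ : C(X, ℂ)) (h0 : ∀ x, φ x ≠ 0)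
    {c : ℂ} (hc : c ≠ 0) (h : ∀ x, ∀ t : ℝ, (t : ℂ) * φ x ≠ c) :
    ∃ ψ : C(X, ℂ), ∀ x, Complex.exp (ψ x) = φ x := by
  have hslit : ∀ x, -φ x / c ∈ Complex.slitPlane := by
    intro x
    rw [Complex.mem_slitPlane_iff]
    by_contra! hcon
    set s := (-φ x / c).re with hs
    have e : -φ x / c = s := Complex.ext (by simp [hs]) (by simpa using hcon.2)
    have hs0 : (s : ℂ) ≠ 0 := by
      rw [← e]; exact div_ne_zero (neg_ne_zero.2 (h0 x)) hc
    refine h x (-s⁻¹) ?_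
    rw [div_eq_iff hc] at e
    push_cast
    rw [neg_mul, ← mul_neg, e, inv_mul_cancel_left₀ hs0]
  refine ⟨⟨fun x => Complex.log (-φ x / c) + Complex.log (-c), ?_⟩, fun x => ?_⟩
  · exact (Continuous.clog (by fun_prop) hslit).add continuous_const
  · simp only [ContinuousMap.coe_mk]
    rw [Complex.exp_add, Complex.exp_log (Complex.slitPlane_ne_zero (hslit x)),
      Complex.exp_log (neg_ne_zero.2 hc)]
    field_simp

/-! ### Dilations, Taylor polynomials and logarithms in the disc. -/

/-- Dominated convergence for the coefficient series, as `|r ^ k - 1| ≤ 1`. -/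
theorem exists_dirichletSum_dilation_sub_le {g : ℂ → ℂ} (hg : DifferentiableOn ℂ g (ball 0 1))
    (hS : dirichletSum g ≠ ⊤) {ε : ℝ} (hε : 0 < ε) :
    ∃ r : ℝ, 0 < r ∧ r < 1 ∧ dirichletSum (fun z => g (r * z) - g z) ≤ ENNReal.ofReal ε := by
  have e : ∀ (k : ℕ) (z : ℂ),
      ((k : ℝ≥0∞) + 1) * ‖z‖ₑ ^ 2 = ENNReal.ofReal ((k + 1) * ‖z‖ ^ 2) :=
    fun k z => by
      rw [ENNReal.ofReal_mul (by positivity), ENNReal.ofReal_pow (norm_nonneg _), ofReal_norm,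
        ENNReal.ofReal_add (by positivity) zero_le_one]
      simp
  have hsum : Summable fun k : ℕ => ((k : ℝ) + 1) * ‖taylorCoeff g k‖ ^ 2 := by
    simp only [dirichletSum, e] at hS
    exact (ENNReal.summable_toReal hS).congr fun k => ENNReal.toReal_ofReal (by positivity)
  have hcoeff : ∀ r : ℝ, 0 < r → r < 1 → taylorCoeff (fun z => g (r * z) - g z) =
      fun k => ((r : ℂ) ^ k - 1) * taylorCoeff g k := by
    intro r hr0 hr1
    refine taylorCoeff_eq_of_hasSum fun z hz => ?_
    have hrz : (r : ℂ) * z ∈ ball (0 : ℂ) 1 := by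
      rw [mem_ball_zero_iff] at hz ⊢
      rw [norm_mul, Complex.norm_real, Real.norm_of_nonneg hr0.le]
      nlinarith [norm_nonneg z]
    refine ((hasSum_taylorCoeff hg hrz).sub (hasSum_taylorCoeff hg hz)).congr_fun fun k => ?_
    ring
  have hlim : Tendsto (fun r : ℝ => ∑' k : ℕ,
      ((k : ℝ) + 1) * ‖((r : ℂ) ^ k - 1) * taylorCoeff g k‖ ^ 2) (𝓝[<] 1) (𝓝 0) := by
    rw [← tsum_zero (α := ℝ) (β := ℕ)]
    refine tendsto_tsum_of_dominated_convergence hsum (fun k => ?_) ?_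
    · have hc : Continuous fun r : ℝ =>
          ((k : ℝ) + 1) * ‖((r : ℂ) ^ k - 1) * taylorCoeff g k‖ ^ 2 := by fun_prop
      simpa using (hc.tendsto 1).mono_left nhdsWithin_le_nhds
    · filter_upwards [Ioo_mem_nhdsLT (zero_lt_one (α := ℝ))] with r hr k
      rw [Real.norm_of_nonneg (by positivity), norm_mul, mul_pow]
      have h1 : ‖(r : ℂ) ^ k - 1‖ ≤ 1 := by
        rw [← Complex.ofReal_pow, ← Complex.ofReal_one, ← Complex.ofReal_sub, Complex.norm_real,
          Real.norm_eq_abs, abs_le]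
        have := pow_le_one₀ (n := k) hr.1.le hr.2.le
        have := pow_nonneg hr.1.le k
        constructor <;> linarith
      have h2 : ‖(r : ℂ) ^ k - 1‖ ^ 2 ≤ 1 := pow_le_one₀ (norm_nonneg _) h1
      gcongr
      exact mul_le_of_le_one_left (by positivity) h2
  obtain ⟨r, hrε, hr⟩ := ((hlim.eventually (gt_mem_nhds hε)).and
    (Ioo_mem_nhdsLT (zero_lt_one (α := ℝ)))).exists
  refine ⟨r, hr.1, hr.2, ?_⟩
  simp only [dirichletSum, hcoeff r hr.1 hr.2, e]
  have hsr : Summable fun k : ℕ => ((k : ℝ) + 1) * ‖((r : ℂ) ^ k - 1) * taylorCoeff g k‖ ^ 2 := by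
    refine Summable.of_nonneg_of_le (fun k => by positivity) (fun k => ?_) hsum
    have h1 : ‖(r : ℂ) ^ k - 1‖ ≤ 1 := by
      rw [← Complex.ofReal_pow, ← Complex.ofReal_one, ← Complex.ofReal_sub, Complex.norm_real,
        Real.norm_eq_abs, abs_le]
      have := pow_le_one₀ (n := k) hr.1.le hr.2.le
      have := pow_nonneg hr.1.le k
      constructor <;> linarith
    rw [norm_mul]
    gcongr
    exact mul_le_of_le_one_left (by positivity) h1
  rw [← ENNReal.ofReal_tsum_of_nonneg (fun k => by positivity) hsr]
  exact ENNReal.ofReal_le_ofReal hrε.le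

theorem AnalyticOnNhd.exists_polynomial_approx {H : ℂ → ℂ}
    (hH : AnalyticOnNhd ℂ H (closedBall 0 1)) {ε δ : ℝ} (hε : 0 < ε) (hδ : 0 < δ) :
    ∃ P : Polynomial ℂ, dirichletSum (fun z => P.eval z - H z) ≤ ENNReal.ofReal ε ∧
      ∀ z ∈ closedBall (0 : ℂ) 1, ‖P.eval z - H z‖ ≤ δ := by
  obtain ⟨R, hR, hd⟩ := hH.exists_ball
  have hsum : Summable fun k => ‖taylorCoeff H k‖ := by
    have := (hasSum_taylorCoeff hd (z := 1) (by simpa using hR)).summable.norm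
    simpa using this
  let p : ℕ → Polynomial ℂ := fun n => ∑ k ∈ Finset.range n, Polynomial.monomial k (taylorCoeff H k)
  have hpe : ∀ n z, (p n).eval z = ∑ k ∈ Finset.range n, taylorCoeff H k * z ^ k := by
    intro n z; simp [p, Polynomial.eval_finsetSum]
  have hunif : ∀ n, ∀ z ∈ closedBall (0 : ℂ) 1,
      ‖(p n).eval z - H z‖ ≤ ∑' k, ‖taylorCoeff H (k + n)‖ := by
    intro n z hz
    have h1 := (hasSum_nat_add_iff' n).2 (hasSum_taylorCoeff hd (closedBall_subset_ball hR hz))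
    rw [← hpe] at h1
    rw [norm_sub_rev, ← h1.tsum_eq]
    refine tsum_of_norm_bounded ((summable_nat_add_iff n).2 hsum).hasSum fun k => ?_
    rw [norm_mul, norm_pow]
    exact mul_le_of_le_one_right (norm_nonneg _)
      (pow_le_one₀ (norm_nonneg _) (mem_closedBall_zero_iff.1 hz))
  have hcoeff : ∀ n, taylorCoeff (fun z => (p n).eval z - H z) =
      fun k => if k < n then 0 else -taylorCoeff H k := by
    intro n
    refine taylorCoeff_eq_of_hasSum fun z hz => ?_
    have h1 : HasSum (fun k => if k ∈ Finset.range n then taylorCoeff H k * z ^ k else 0)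
        ((p n).eval z) := by
      rw [hpe, Finset.sum_congr rfl fun k hk => (if_pos hk).symm]
      exact hasSum_sum_of_ne_finset_zero fun k hk => if_neg hk
    refine (h1.sub (hasSum_taylorCoeff hH.differentiableOn_ball hz)).congr_fun fun k => ?_
    by_cases h : k < n <;> simp [h]
  have hSn : ∀ n, dirichletSum (fun z => (p n).eval z - H z) ≤
      ∑' k, (((k + n : ℕ) : ℝ≥0∞) + 1) * ‖taylorCoeff H (k + n)‖ₑ ^ 2 := by
    intro n
    rw [dirichletSum, hcoeff, ← ENNReal.summable.sum_add_tsum_nat_add' (k := n),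
      Finset.sum_eq_zero, zero_add]
    · refine ENNReal.tsum_le_tsum fun k => ?_
      simp
    · intro k hk
      simp [Finset.mem_range.1 hk]
  have h1 := ENNReal.tendsto_sum_nat_add
    (fun k : ℕ => ((k : ℝ≥0∞) + 1) * ‖taylorCoeff H k‖ₑ ^ 2) hH.dirichletSum_ne_top
  have h2 := tendsto_sum_nat_add fun k => ‖taylorCoeff H k‖
  obtain ⟨n, hn1, hn2⟩ := ((h1.eventually (ge_mem_nhds (ENNReal.ofReal_pos.2 hε))).and
    (h2.eventually (ge_mem_nhds hδ))).exists
  exact ⟨p n, (hSn n).trans hn1, fun z hz => (hunif n z hz).trans hn2⟩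

/-- Take a primitive `l` of `g' / g` with `l 0 = log (g 0)`; then `g exp (-l)` has zero derivative.
-/
theorem exists_holomorphic_log {g : ℂ → ℂ} (hg : DifferentiableOn ℂ g (ball 0 1))
    (hg0 : ∀ z ∈ ball (0 : ℂ) 1, g z ≠ 0) :
    ∃ l : ℂ → ℂ, DifferentiableOn ℂ l (ball 0 1) ∧
      ∀ z ∈ ball (0 : ℂ) 1, Complex.exp (l z) = g z := by
  obtain ⟨l, hl0, hl⟩ := ((((hg.deriv isOpen_ball).div hg hg0).isExactOn_ball).with_val_at 0
    (Complex.log (g 0)))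
  refine ⟨l, fun z hz => (hl z hz).differentiableAt.differentiableWithinAt, fun z hz => ?_⟩
  have hconst : ∀ w ∈ ball (0 : ℂ) 1, HasDerivAt (fun w => g w * Complex.exp (-l w)) 0 w := by
    intro w hw
    have h1 := (hg.differentiableAt (isOpen_ball.mem_nhds hw)).hasDerivAt
    refine (h1.mul (hl w hw).fun_neg.cexp).congr_deriv ?_
    have := hg0 w hw
    simp only [Pi.div_apply]
    field_simp
    ring
  have h2 := (convex_ball (0 : ℂ) 1).is_const_of_fderivWithin_eq_zero (𝕜 := ℂ)
    (f := fun w => g w * Complex.exp (-l w))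
    (fun w hw => (hconst w hw).differentiableAt.differentiableWithinAt)
    (fun w hw => by
      rw [fderivWithin_of_isOpen isOpen_ball hw]
      ext; simp [(hconst w hw).deriv])
    hz (mem_ball_self one_pos)
  simp only [hl0] at h2
  rw [Complex.exp_neg, Complex.exp_neg, Complex.exp_log (hg0 0 (by simp)),
    mul_inv_cancel₀ (hg0 0 (by simp))] at h2
  field_simp at h2
  exact h2.symm

/-! ### Assembling the approximants. -/

theorem exists_continuousMap_log_approx {E : Set ℂ} (hEc : IsClosed E) (hE : E ⊆ sphere 0 1)
    (hcap : logCapacity E = 0) (f : C(E, ℂ)) (hf0 : ∀ ζ : E, f ζ ≠ 0) {ε : ℝ} (hε : 0 < ε) :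
    ∃ φ : C(E, ℂ), ∀ ζ : E, ‖Complex.exp (φ ζ) - f ζ‖ ≤ ε := by
  have hEk : IsCompact E := (isCompact_sphere (0 : ℂ) 1).of_isClosed_subset hEc hE
  have hcomp : CompactSpace E := isCompact_iff_compactSpace.1 hEk
  obtain ⟨m, hm0, hm⟩ : ∃ m : ℝ, 0 < m ∧ ∀ ζ : E, m ≤ ‖f ζ‖ := by
    have := isCompact_univ.exists_forall_le' (f := fun ζ : E => ‖f ζ‖) (a := (0 : ℝ))
      (by fun_prop) (fun ζ _ => norm_pos_iff.2 (hf0 ζ))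
    obtain ⟨m, hm0, hm⟩ := this
    exact ⟨m, hm0, fun ζ => hm ζ (mem_univ _)⟩
  -- An error below the minimum `m` of `|f|` keeps the Laurent polynomial zero-free on `E`.
  obtain ⟨N, P, hP⟩ := exists_laurent_approx hEk hE f (lt_min hε hm0)
  have hF : ∀ z ∈ sphere (0 : ℂ) 1, DifferentiableAt ℂ (fun z => P.eval z / z ^ N) z := by
    intro z hz
    refine P.differentiable.differentiableAt.fun_div (by fun_prop) (pow_ne_zero _ ?_)
    exact norm_ne_zero_iff.1 (by simp [mem_sphere_zero_iff_norm.1 hz])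
  obtain ⟨c, hc, hray⟩ := exists_ray_avoided hE (volume_angles_eq_zero hEc hE hcap) hF
  obtain ⟨φ, hφ⟩ := exists_continuous_log
    (X := E) ⟨fun ζ => P.eval (ζ : ℂ) / (ζ : ℂ) ^ N, by
      refine ContinuousOn.comp_continuous (s := sphere 0 1) (f := fun ζ : E => (ζ : ℂ))
        (fun z hz => (hF z hz).continuousAt.continuousWithinAt) (by fun_prop) fun ζ => hE ζ.2⟩
    (fun ζ h => by
      have h1 := (hP ζ).trans_le (min_le_right _ _)
      simp only [ContinuousMap.coe_mk] at h
      rw [h, zero_sub, norm_neg] at h1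
      exact absurd h1 (not_lt.2 (hm ζ)))
    hc (fun ζ t => hray ζ ζ.2 t)
  refine ⟨φ, fun ζ => ?_⟩
  rw [hφ]
  exact ((hP ζ).trans_le (min_le_left _ _)).le

/-- `q = P h`, with `P / z ^ N` close to `ψ` and `h` close to `z ^ (-N)` on `E`. That `c` precedes
`ε` is essential: the norm of `exp q - 1` is controlled by `exp c` times that of `q`. -/
theorem exists_small_interpolant {E : Set ℂ} (hEc : IsClosed E) (hE : E ⊆ sphere 0 1)
    (hcap : logCapacity E = 0) (ψ : C(E, ℂ)) {δ : ℝ} (hδ : 0 < δ) :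
    ∃ c : ℝ, 0 ≤ c ∧ ∀ ε > 0, ∃ q : ℂ → ℂ, AnalyticOnNhd ℂ q (closedBall 0 1) ∧
      dirichletSum q ≤ ENNReal.ofReal ε ∧ (∀ z ∈ closedBall (0 : ℂ) 1, ‖q z‖ ≤ c) ∧
      ∀ ζ : E, ‖q ζ - ψ ζ‖ ≤ δ := by
  have hEk : IsCompact E := (isCompact_sphere (0 : ℂ) 1).of_isClosed_subset hEc hE
  obtain ⟨N, P, hP⟩ := exists_laurent_approx hEk hE ψ (half_pos hδ)
  have hPan : AnalyticOnNhd ℂ (fun z => P.eval z) (closedBall 0 1) :=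
    P.differentiable.differentiableOn.analyticOnNhd_closedBall one_lt_two
  obtain ⟨B, hB⟩ := (isCompact_closedBall (0 : ℂ) 1).exists_bound_of_continuousOn hPan.continuousOn
  obtain ⟨K, hK, hmul⟩ := hPan.exists_dirichletSum_mul_le
  have hB0 : 0 ≤ B := (norm_nonneg _).trans (hB 0 (by simp))
  -- `|P| ≤ B` and `|h| ≤ N + 2` on the circle; the maximum principle carries the bound inside.
  refine ⟨B * (N + 2), by positivity, fun ε hε => ?_⟩
  obtain ⟨h, han, hS, hhE, hb⟩ := exists_cutoff hEc hE hcap N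
    (η := min (δ / (2 * (B + 1))) (ε / (K.toReal + 1))) (by positivity)
  have hqan : AnalyticOnNhd ℂ (fun z => P.eval z * h z) (closedBall 0 1) := hPan.mul han
  refine ⟨fun z => P.eval z * h z, hqan, ?_, fun z hz => ?_, fun ζ => ?_⟩
  · refine (hmul h han.differentiableOn_ball).trans ?_
    calc K * dirichletSum h ≤ ENNReal.ofReal K.toReal * ENNReal.ofReal (ε / (K.toReal + 1)) := by
          rw [ENNReal.ofReal_toReal hK]
          gcongr
          exact hS.trans (ENNReal.ofReal_le_ofReal (min_le_right _ _))
      _ ≤ ENNReal.ofReal ε := by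
          rw [← ENNReal.ofReal_mul ENNReal.toReal_nonneg]
          refine ENNReal.ofReal_le_ofReal ?_
          have hK0 : 0 ≤ K.toReal := ENNReal.toReal_nonneg
          rw [mul_div_assoc', div_le_iff₀ (by positivity)]
          nlinarith
  · refine Complex.norm_le_of_forall_mem_frontier_norm_le (isBounded_ball (x := (0 : ℂ)) (r := 1))
      (f := fun z => P.eval z * h z) ?_ (fun w hw => ?_) (by rwa [closure_ball _ one_ne_zero])
    · refine DifferentiableOn.diffContOnCl ?_
      rw [closure_ball _ one_ne_zero]
      exact hqan.differentiableOn
    · rw [frontier_ball _ one_ne_zero] at hw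
      rw [norm_mul]
      exact mul_le_mul (hB w (sphere_subset_closedBall hw)) (hb w hw) (norm_nonneg _) hB0
  · have hζ1 := mem_sphere_zero_iff_norm.1 (hE ζ.2)
    have hζ0 : (ζ : ℂ) ≠ 0 := norm_ne_zero_iff.1 (by simp [hζ1])
    have e : P.eval (ζ : ℂ) * h ζ - ψ ζ = P.eval (ζ : ℂ) / (ζ : ℂ) ^ N * ((ζ : ℂ) ^ N * h ζ - 1) +
        (P.eval (ζ : ℂ) / (ζ : ℂ) ^ N - ψ ζ) := by
      field_simp
      ring
    rw [e]
    refine (norm_add_le _ _).trans ?_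
    rw [norm_mul, norm_div, norm_pow, hζ1, one_pow, div_one]
    have h1 := hhE ζ ζ.2
    have h2 := hB ζ (sphere_subset_closedBall (hE ζ.2))
    have h3 : ‖P.eval (ζ : ℂ)‖ * ‖(ζ : ℂ) ^ N * h ζ - 1‖ ≤ B * (δ / (2 * (B + 1))) :=
      mul_le_mul h2 (h1.trans (min_le_left _ _)) (norm_nonneg _) hB0
    have h4 : B * (δ / (2 * (B + 1))) ≤ δ / 2 := by
      rw [mul_div_assoc', div_le_div_iff₀ (by positivity) (by positivity)]
      nlinarith
    linarith [hP ζ]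

theorem exists_polynomial_simultaneous_approx {E : Set ℂ} (hEc : IsClosed E)
    (hE : E ⊆ sphere 0 1) (hcap : logCapacity E = 0) {g : ℂ → ℂ}
    (hg : DifferentiableOn ℂ g (ball 0 1)) (hgS : dirichletSum g ≠ ⊤)
    (hg0 : ∀ z ∈ ball (0 : ℂ) 1, g z ≠ 0) (f : C(E, ℂ)) (hf0 : ∀ ζ : E, f ζ ≠ 0)
    {ε : ℝ} (hε : 0 < ε) :
    ∃ P : Polynomial ℂ, (∀ z ∈ closedBall (0 : ℂ) 1, P.eval z ≠ 0) ∧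
      dirichletSum (fun z => P.eval z - g z) ≤ ENNReal.ofReal ε ∧
      ∀ ζ : E, ‖P.eval (ζ : ℂ) - f ζ‖ ≤ ε := by
  have hcomp : CompactSpace E := isCompact_iff_compactSpace.1
    ((isCompact_sphere (0 : ℂ) 1).of_isClosed_subset hEc hE)
  -- Splitting `P - g` as `(P - H) + (g_r (exp q - 1) + (g_r - g))` weights the squared norms by
  -- `2`, `4`, `4`, hence `ε / 10` each.
  obtain ⟨r, hr0, hr1, hr⟩ := exists_dirichletSum_dilation_sub_le hg hgS
    (show 0 < ε / 10 by positivity)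
  obtain ⟨l, hl, hlg⟩ := exists_holomorphic_log hg hg0
  have hmem : ∀ z ∈ closedBall (0 : ℂ) 1, (r * z : ℂ) ∈ ball (0 : ℂ) 1 := fun z hz => by
    rw [mem_closedBall_zero_iff] at hz
    rw [mem_ball_zero_iff, norm_mul, Complex.norm_real, Real.norm_of_nonneg hr0.le]
    nlinarith [norm_nonneg z]
  have hLan : AnalyticOnNhd ℂ (fun z => l (r * z)) (closedBall 0 1) :=
    fun z hz => (hl.analyticAt (isOpen_ball.mem_nhds (hmem z hz))).comp
      (f := fun z : ℂ => (r : ℂ) * z) (analyticAt_const.mul analyticAt_id)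
  have hGan : AnalyticOnNhd ℂ (fun z => Complex.exp (l (r * z))) (closedBall 0 1) :=
    fun z hz => (hLan z hz).cexp
  obtain ⟨φ, hφ⟩ := exists_continuousMap_log_approx hEc hE hcap f hf0
    (show 0 < ε / 2 by positivity)
  obtain ⟨B, hB⟩ := isCompact_univ.exists_bound_of_continuousOn (f := fun ζ : E => Complex.exp (φ ζ))
    (by fun_prop)
  set b := max B 1 with hb
  have hb1 : 1 ≤ b := le_max_right _ _
  have hbB : ∀ ζ : E, ‖Complex.exp (φ ζ)‖ ≤ b := fun ζ => (hB ζ (mem_univ _)).trans (le_max_left _ _)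
  let ψ : C(E, ℂ) := ⟨fun ζ => φ ζ - l (r * ζ), φ.continuous.sub
    (hLan.continuousOn.comp_continuous (f := fun ζ : E => (ζ : ℂ)) (by fun_prop)
      fun ζ => sphere_subset_closedBall (hE ζ.2))⟩
  -- From `|exp x - 1| ≤ 2|x|` for `|x| ≤ 1`, the error on `E` is at most `b · 2δ ≤ ε / 6`.
  set δ := min 1 (ε / (12 * b)) with hδ
  have hδ0 : 0 < δ := by positivity
  obtain ⟨c, hc0, hq⟩ := exists_small_interpolant hEc hE hcap ψ hδ0
  obtain ⟨K, hK, hmul⟩ := hGan.exists_dirichletSum_mul_le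
  set C : ℝ≥0∞ := K * (3 * ENNReal.ofReal (Real.exp c) ^ 2) with hC
  have hCt : C ≠ ⊤ := by finiteness
  obtain ⟨q, hqan, hqS, hqc, hqE⟩ := hq (ε / 10 / (C.toReal + 1)) (by positivity)
  have hqre : ∀ z ∈ ball (0 : ℂ) 1, (q z).re ≤ c := fun z hz =>
    (Complex.re_le_norm _).trans (hqc z (ball_subset_closedBall hz))
  have hS1 : dirichletSum (fun z => Complex.exp (l (r * z)) * (Complex.exp (q z) - 1)) ≤
      ENNReal.ofReal (ε / 10) := by
    calc dirichletSum (fun z => Complex.exp (l (r * z)) * (Complex.exp (q z) - 1))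
        ≤ K * dirichletSum (fun z => Complex.exp (q z) - 1) :=
          hmul _ (hqan.differentiableOn_ball.cexp.sub_const 1)
      _ ≤ K * (3 * ENNReal.ofReal (Real.exp c) ^ 2 * dirichletSum q) := by
          gcongr
          exact dirichletSum_exp_sub_one_le hc0 hqan.differentiableOn_ball hqre
      _ = C * dirichletSum q := by rw [hC]; ring
      _ ≤ ENNReal.ofReal C.toReal * ENNReal.ofReal (ε / 10 / (C.toReal + 1)) := by
          rw [ENNReal.ofReal_toReal hCt]; gcongr
      _ ≤ ENNReal.ofReal (ε / 10) := by
          rw [← ENNReal.ofReal_mul ENNReal.toReal_nonneg]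
          refine ENNReal.ofReal_le_ofReal ?_
          have hC0 : 0 ≤ C.toReal := ENNReal.toReal_nonneg
          rw [mul_div_assoc', div_le_iff₀ (by positivity)]
          nlinarith
  set H : ℂ → ℂ := fun z => Complex.exp (l (r * z)) * Complex.exp (q z) with hH
  have hHan : AnalyticOnNhd ℂ H (closedBall 0 1) := fun z hz => (hGan z hz).mul (hqan z hz).cexp
  have hH0 : ∀ z, H z ≠ 0 := fun z => mul_ne_zero (Complex.exp_ne_zero _) (Complex.exp_ne_zero _)
  obtain ⟨m, hm0, hm⟩ := (isCompact_closedBall (0 : ℂ) 1).exists_forall_le' (f := fun z => ‖H z‖)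
    (a := (0 : ℝ)) hHan.continuousOn.norm (fun z _ => norm_pos_iff.2 (hH0 z))
  -- An error of at most half of a positive lower bound for `|H|` leaves `P` zero-free on the closed
  -- disc.
  obtain ⟨P, hPS, hP⟩ := hHan.exists_polynomial_approx (show 0 < ε / 10 by positivity)
    (show 0 < min (m / 2) (ε / 4) by positivity)
  refine ⟨P, fun z hz h => ?_, ?_, fun ζ => ?_⟩
  · have h1 := (hP z hz).trans (min_le_left _ _)
    rw [h, zero_sub, norm_neg] at h1
    have h2 := hm z hz
    linarith
  · have hgr : DifferentiableOn ℂ (fun z => g (r * z) - g z) (ball 0 1) := by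
      refine DifferentiableOn.sub ?_ hg
      exact hg.comp (f := fun z : ℂ => (r : ℂ) * z) (by fun_prop)
        fun z hz => hmem z (ball_subset_closedBall hz)
    have hexp : DifferentiableOn ℂ (fun z => Complex.exp (l (r * z)) * (Complex.exp (q z) - 1))
        (ball 0 1) := hGan.differentiableOn_ball.mul (hqan.differentiableOn_ball.cexp.sub_const 1)
    have hPH : DifferentiableOn ℂ (fun z => P.eval z - H z) (ball 0 1) :=
      P.differentiable.differentiableOn.sub hHan.differentiableOn_ball
    have e : EqOn (fun z => P.eval z - g z) (fun z => (P.eval z - H z) +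
        (Complex.exp (l (r * z)) * (Complex.exp (q z) - 1) + (g (r * z) - g z))) (ball 0 1) := by
      intro z hz
      simp only [hH]
      rw [hlg _ (hmem z (ball_subset_closedBall hz))]
      ring
    rw [dirichletSum_congr (hPH.add (hexp.add hgr)) e]
    calc _ ≤ _ := dirichletSum_add_le hPH (hexp.add hgr)
      _ ≤ 2 * ENNReal.ofReal (ε / 10) +
          2 * (2 * ENNReal.ofReal (ε / 10) + 2 * ENNReal.ofReal (ε / 10)) := by
        refine add_le_add (mul_le_mul_right hPS _) (mul_le_mul_right ?_ _)
        refine (dirichletSum_add_le hexp hgr).trans ?_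
        gcongr
      _ = 10 * ENNReal.ofReal (ε / 10) := by ring
      _ = ENNReal.ofReal ε := by
        rw [← ENNReal.ofReal_ofNat, ← ENNReal.ofReal_mul (by norm_num)]
        congr 1
        ring
  · have hζ : (ζ : ℂ) ∈ closedBall (0 : ℂ) 1 := sphere_subset_closedBall (hE ζ.2)
    have h1 := (hP ζ hζ).trans (min_le_right _ _)
    have h2 : ‖H ζ - Complex.exp (φ ζ)‖ ≤ ε / 4 := by
      have e : H ζ - Complex.exp (φ ζ) =
          Complex.exp (φ ζ) * (Complex.exp (q ζ - ψ ζ) - 1) := by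
        simp only [hH, ψ, ContinuousMap.coe_mk]
        rw [mul_sub, mul_one, ← Complex.exp_add, ← Complex.exp_add]
        congr 2
        ring
      have hd := hqE ζ
      have hd1 : ‖q ζ - ψ ζ‖ ≤ 1 := hd.trans (min_le_left _ _)
      have h3 := Complex.norm_exp_sub_one_le hd1
      rw [e, norm_mul]
      calc ‖Complex.exp (φ ζ)‖ * ‖Complex.exp (q ζ - ψ ζ) - 1‖ ≤ b * (2 * (ε / (12 * b))) := by
            refine mul_le_mul (hbB ζ) (h3.trans ?_) (norm_nonneg _) (by positivity)
            have := hd.trans (min_le_right _ _)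
            linarith
        _ = ε / 6 := by field_simp; ring
        _ ≤ ε / 4 := by linarith
    have h3 := hφ ζ
    calc ‖P.eval (ζ : ℂ) - f ζ‖ = ‖(P.eval (ζ : ℂ) - H ζ) + (H ζ - Complex.exp (φ ζ)) +
          (Complex.exp (φ ζ) - f ζ)‖ := by congr 1; ring
      _ ≤ ε / 4 + ε / 4 + ε / 2 := (norm_add_le _ _).trans
          (add_le_add ((norm_add_le _ _).trans (add_le_add h1 h2)) h3)
      _ = ε := by ring

theorem dirichletSum_ne_top_of_mem {g : ℂ → ℂ} (hg : g ∈ dirichletSpace) : dirichletSum g ≠ ⊤ := by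
  have h := dirichletSum_le hg.1
  have h1 : dirichletIntegral g ≠ ⊤ := hg.2.ne
  exact ne_top_of_le_ne_top (by finiteness) h

theorem theorem4p3 (E : Set ℂ) (hE : IsClosed E) (hET : E ⊆ Metric.sphere (0 : ℂ) 1)
    (hcap : logCapacity E = 0)
    (g : ℂ → ℂ) (hg : g ∈ dirichletSpace) (hg0 : ∀ z ∈ Metric.ball (0 : ℂ) 1, g z ≠ 0)
    (f : C(E, ℂ)) (hf0 : ∀ ζ : E, f ζ ≠ 0) :
    ∃ P : ℕ → Polynomial ℂ,
      (∀ n, ∀ z ∈ Metric.closedBall (0 : ℂ) 1, (P n).eval z ≠ 0) ∧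
      Filter.Tendsto (fun n => dirichletNorm (fun z => (P n).eval z - g z))
        Filter.atTop (𝓝 0) ∧
      TendstoUniformly (fun n (ζ : E) => (P n).eval (ζ : ℂ)) f Filter.atTop := by
  have h := fun n : ℕ => exists_polynomial_simultaneous_approx hE hET hcap hg.1
    (dirichletSum_ne_top_of_mem hg) hg0 f hf0 (ε := 1 / ((n : ℝ) + 1)) (by positivity)
  choose P hP0 hPS hPf using h
  have hlim := tendsto_one_div_add_atTop_nhds_zero_nat (𝕜 := ℝ)
  refine ⟨P, hP0, ?_, ?_⟩
  · have h1 : Tendsto (fun n => dirichletSum (fun z => (P n).eval z - g z)) atTop (𝓝 0) := by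
      have h2 := (ENNReal.continuous_ofReal.tendsto 0).comp hlim
      rw [ENNReal.ofReal_zero] at h2
      exact tendsto_of_tendsto_of_tendsto_of_le_of_le tendsto_const_nhds h2 (fun _ => zero_le)
        hPS
    have h3 := ((ENNReal.continuous_rpow_const (y := (1 / 2 : ℝ))).tendsto 0).comp h1
    rw [ENNReal.zero_rpow_of_pos (by norm_num)] at h3
    refine h3.congr fun n => ?_
    exact (dirichletNorm_eq ((P n).differentiable.differentiableOn.fun_sub hg.1)).symm
  · rw [Metric.tendstoUniformly_iff]
    intro ε hε
    filter_upwards [hlim.eventually (gt_mem_nhds hε)] with n hn ζ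
    rw [dist_comm, dist_eq_norm]
    exact (hPf n ζ).trans_lt hn
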